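/- Let $\mathbb{X} \subset \mathbb{R}^{d}$ and $\mathbb{Y} \subset \mathbb{R}^{m}$ be compact and convex. Let $\sigma$ be an absolutely continuous probability measure on $\mathbb{X} \times \mathbb{Y}$ whose marginal $\mu$ on $\mathbb{X}$ has a density bounded below by a positive constant almost everywhere on $\mathbb{X}$. Let $\ell : \mathbb{Y} \times \mathbb{Y} \to \mathbb{R}_{\geq 0}$ be Lipschitz continuous, and strictly convex in its first argument. For a measurable map $f : \mathbb{X} \to \mathbb{Y}$ let $L_\sigma(f) = \mathbb{E}_{(x,y) \sim \sigma}[\ell(f(x),y)]$. For $\alpha \geq 0$ let $J^*_\sigma(\alpha)$ be the infimum of $L_\sigma(f)$ over all maps $f : \mathbb{X} \to \mathbb{Y}$ with Lipschitz constant at most $\alpha$. For $1 \leq p \leq \infty$ let $W^{1,p}((\mathbb{X},\mu);\mathbb{Y})$ be the set of measurable maps $f : \mathbb{X} \to \mathbb{Y}$ with $|f| \in L^p(\mathbb{X},\mu)$ that have a weak gradient $\nabla f$ in the interior of $\mathbb{X}$ with $|\nabla f| \in L^p(\mathbb{X},\mu)$, where $|\nabla f|$ is the pointwise Hilbert-Schmidt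 norm. For $\epsilon > 0$ and $1 < p \leq \infty$ consider the problem $$(P_p) \qquad \inf \left\{ \| |\nabla f| \|_{L^p(\mathbb{X},\mu)} \; : \; f \in W^{1,p}((\mathbb{X},\mu);\mathbb{Y}), \; L_\sigma(f) \leq J^*_\sigma(\alpha) + \epsilon \right\}.$$ Then for every $\alpha \geq 0$ and every $\epsilon > 0$ the minimum in $(P_p)$ is attained for every $p \in \mathbb{N}_{>1}$ and for $p = \infty$, and $$\lim_{p \to \infty} \; \min_{\substack{f \in W^{1,p}((\mathbb{X},\mu);\mathbb{Y}) \\ L_\sigma(f) \leq J^*_\sigma(\alpha)+\epsilon}} \| |\nabla f| \|_{L^p(\mathbb{X},\mu)} \; = \; \min_{\substack{f \in W^{1,\infty}((\mathbb{X},\mu);\mathbb{Y}) \\ L_\sigma(f) \leq J^*_\sigma(\alpha)+\epsilon}} \| |\nabla f| \|_{L^\infty(\mathbb{X},\mu)}.$$ Moreover, let $\{f^{\epsilon,p}\}_{p \in \mathbb{N}_{>1}}$ be any sequence such that $f^{\epsilon,p}$ is a minimizer of $(P_p)$ for each $p$. For $p > d$ the map $f^{\epsilon,p}$ has a representative ($\mu$-almost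 everywhere equal to it) that is a continuous map $\mathbb{X} \to \mathbb{Y}$, and every subsequence of these representatives has a further subsequence that converges uniformly on $\mathbb{X}$ to a global minimizer $f^{\epsilon,\infty}$ of $(P_\infty)$. -/

import Mathlib

open MeasureTheory Set Filter Topology
open scoped ENNReal NNReal

noncomputable section

/-- `EucSp d` is `ℝ^d` with the Euclidean norm. -/
abbrev EucSp (d : ℕ) : Type := EuclideanSpace ℝ (Fin d)

/-- The Hilbert-Schmidt norm of a linear map between Euclidean spaces. -/
def hsNorm {d m : ℕ} (A : EucSp d →L[ℝ] EucSp m) : ℝ :=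
  Real.sqrt (∑ i : Fin d, ‖A (EuclideanSpace.single i (1 : ℝ))‖ ^ 2)

/-- `G` is a weak gradient of `f` on the open set `Ω`: both are locally integrable on `Ω`
(Lebesgue measure), and integration by parts holds against every smooth `φ` with compact
support in `Ω`, in every direction `v`. -/
def HasWeakGrad {d m : ℕ} (Ω : Set (EucSp d)) (f : EucSp d → EucSp m)
    (G : EucSp d → EucSp d →L[ℝ] EucSp m) : Prop :=
  LocallyIntegrableOn f Ω volume ∧ LocallyIntegrableOn G Ω volume ∧
    ∀ φ : EucSp d → ℝ, ContDiff ℝ (⊤ : ℕ∞) φ → HasCompactSupport φ → tsupport φ ⊆ Ω →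
      ∀ v : EucSp d,
        ∫ x in Ω, (fderiv ℝ φ x v) • f x = - ∫ x in Ω, φ x • G x v

open Classical in
/-- The weak gradient of `f` on `Ω` (unique up to null sets; `0` if there is none). -/
def weakGrad {d m : ℕ} (Ω : Set (EucSp d)) (f : EucSp d → EucSp m) :
    EucSp d → EucSp d →L[ℝ] EucSp m :=
  if h : ∃ G, HasWeakGrad Ω f G then h.choose else 0

/-- The pointwise Hilbert-Schmidt norm `|∇f|` of the weak gradient of `f` in the interior
of `X`. -/
def gradNorm {d m : ℕ} (X : Set (EucSp d)) (f : EucSp d → EucSp m) : EucSp d → ℝ :=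
  fun x => hsNorm (weakGrad (interior X) f x)

/-- Membership of (a representative) `f` in `W^{1,p}((X,μ);Y)`, `1 ≤ p ≤ ∞`: `f` maps `X` to `Y`,
is in `L^p(μ)`, and has a weak gradient with `|∇f|` in `L^p(μ)`. Here `μ` lives on `X`. -/
def MemSobolev {d m : ℕ} (X : Set (EucSp d)) (Y : Set (EucSp m)) (μ : Measure (EucSp d))
    (p : ℝ≥0∞) (f : EucSp d → EucSp m) : Prop :=
  MapsTo f X Y ∧ MemLp f p μ ∧ (∃ G, HasWeakGrad (interior X) f G) ∧ MemLp (gradNorm X f) p μ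

/-- The seminorm `‖ |∇f| ‖_{L^p(X,μ)}`, `1 ≤ p ≤ ∞`. -/
def sobolevSeminorm {d m : ℕ} (X : Set (EucSp d)) (μ : Measure (EucSp d)) (p : ℝ≥0∞)
    (f : EucSp d → EucSp m) : ℝ≥0∞ :=
  eLpNorm (gradNorm X f) p μ

/-- The expected loss `L_σ(f) = 𝔼_{(x,y) ∼ σ} ℓ(f(x), y)`. -/
def expectedLoss {d m : ℕ} (σ : Measure (EucSp d × EucSp m)) (ℓ : EucSp m → EucSp m → ℝ)
    (f : EucSp d → EucSp m) : ℝ :=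
  ∫ z, ℓ (f z.1) z.2 ∂σ

/-- `J*_σ(α)`: the infimum of the expected loss over the maps `X → Y` with Lipschitz constant at
most `α`. -/
def optimalLoss {d m : ℕ} (X : Set (EucSp d)) (Y : Set (EucSp m))
    (σ : Measure (EucSp d × EucSp m)) (ℓ : EucSp m → EucSp m → ℝ) (α : ℝ≥0) : ℝ :=
  sInf (expectedLoss σ ℓ '' {f | MapsTo f X Y ∧ LipschitzOnWith α f X})

/-- The maps in `W^{1,p}((X,μ);Y)`, with `μ` the first marginal of `σ`, whose expected loss is at
most `J*_σ(α) + ε`. -/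
def feasibleSet {d m : ℕ} (X : Set (EucSp d)) (Y : Set (EucSp m))
    (σ : Measure (EucSp d × EucSp m)) (ℓ : EucSp m → EucSp m → ℝ) (α : ℝ≥0) (ε : ℝ)
    (p : ℝ≥0∞) : Set (EucSp d → EucSp m) :=
  {f | MemSobolev X Y σ.fst p f ∧ expectedLoss σ ℓ f ≤ optimalLoss X Y σ ℓ α + ε}

/-- `f` is a global minimizer of the loss-constrained `W^{1,p}`-seminorm problem. -/
def IsLossConstrainedMin {d m : ℕ} (X : Set (EucSp d)) (Y : Set (EucSp m))
    (σ : Measure (EucSp d × EucSp m)) (ℓ : EucSp m → EucSp m → ℝ) (α : ℝ≥0) (ε : ℝ)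
    (p : ℝ≥0∞) (f : EucSp d → EucSp m) : Prop :=
  f ∈ feasibleSet X Y σ ℓ α ε p ∧
    IsMinOn (sobolevSeminorm X σ.fst p) (feasibleSet X Y σ ℓ α ε p) f

/-- The optimal value of the loss-constrained `W^{1,p}`-seminorm problem. -/
def lossConstrainedValue {d m : ℕ} (X : Set (EucSp d)) (Y : Set (EucSp m))
    (σ : Measure (EucSp d × EucSp m)) (ℓ : EucSp m → EucSp m → ℝ) (α : ℝ≥0) (ε : ℝ)
    (p : ℝ≥0∞) : ℝ≥0∞ :=
  ⨅ f ∈ feasibleSet X Y σ ℓ α ε p, sobolevSeminorm X σ.fst p f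

end

/-! The existence and limit statements rest on one compactness principle. Pair each map with a weak
gradient. The pairs with values in `Y` and loss below the threshold form a convex set, because `Y`
is convex and the loss is convex in its first argument. Replacing a gradient by its columns turns
the Hilbert-Schmidt norm into a Hilbert norm, and since `p ∈ ℕ`, `p > 1` means `p ≥ 2`, a bound in
`L^p` of a probability measure is a bound in `L²`. Instead of weak compactness, convex combinations
of the tails are used: the elements of least norm in the closed convex hulls of the tails form a
Cauchy sequence. Combinations stay admissible, they converge strongly, and so integration by parts,
the loss bound and (by Fatou) the seminorm bounds pass to the limit. This is
`exists_admissible_limit`.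

With a constant exponent it yields attainment. The problem is never void: a nearly optimal
`α`-Lipschitz map extends to a Lipschitz map of the whole space, whose derivative is a bounded weak
gradient. With exponents tending to infinity, the limit of minimizers has all its `L^n` seminorms
bounded by the supremum of the values, hence also its `L^∞` seminorm. As the values increase with
`p` and never exceed the value at `∞`, they converge to it.

Uniform convergence needs a Morrey estimate valid up to the boundary. For `x ∈ X`, average `f`
against a fixed smooth weight contracted towards `x` by a factor `s ≥ 1`; convexity of `X` keeps the
average inside. The derivative in `s` is an integral of the gradient, and an `L^{d+1}` bound makes
the averages at scales `2^k` converge geometrically, uniformly in `x` and `f`. At each fixed scale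
they are uniformly Lipschitz, so the limits are equicontinuous representatives. Arzelà-Ascoli gives
a uniformly convergent subsequence, and the compactness principle recognizes its limit as a
minimizer for `∞`. -/

/-! ### Convex combinations of tails in Hilbert space and in `L²` -/

/-- In a Hilbert space, the closed convex hulls of the tails of a bounded sequence have a common
point, which is moreover the norm limit of convex combinations of the tails. -/
theorem exists_tendsto_convexHull_tail {H : Type*} [NormedAddCommGroup H] [InnerProductSpace ℝ H]
    [CompleteSpace H] (u : ℕ → H) (R : ℝ) (hu : ∀ n, ‖u n‖ ≤ R) :
    ∃ w : ℕ → H, ∃ h : H, (∀ n, w n ∈ convexHull ℝ (u '' Ici n)) ∧ Tendsto w atTop (𝓝 h) := by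
  set C : ℕ → Set H := fun n => closure (convexHull ℝ (u '' Ici n)) with hC
  have hCconv : ∀ n, Convex ℝ (C n) := fun n => (convex_convexHull ℝ _).closure
  have hne : ∀ n, (C n).Nonempty := fun n =>
    ⟨u n, subset_closure (subset_convexHull ℝ _ ⟨n, le_refl n, rfl⟩)⟩
  have hanti : ∀ {n k}, n ≤ k → C k ⊆ C n := fun {n k} h =>
    closure_mono (convexHull_mono (image_mono (Ici_subset_Ici.2 h)))
  -- `c n` is the element of least norm in the `n`-th closed hull. The hulls decrease, so the norms
  -- increase and stay bounded; the variational inequality for projections turns increments of `‖c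
  -- n‖ ^ 2` into bounds on squared distances.
  choose c hcm hc using fun n => exists_norm_eq_iInf_of_complete_convex (hne n)
    isClosed_closure.isComplete (hCconv n) (0 : H)
  have hinner : ∀ n, ∀ y ∈ C n, ‖c n‖ ^ 2 ≤ inner ℝ (c n) y := by
    intro n y hy
    have := (norm_eq_iInf_iff_real_inner_le_zero (hCconv n) (hcm n)).1 (hc n) y hy
    rw [zero_sub, inner_neg_left, inner_sub_right, real_inner_self_eq_norm_sq] at this
    linarith
  have hsq : ∀ {n k}, n ≤ k → ‖c k - c n‖ ^ 2 ≤ ‖c k‖ ^ 2 - ‖c n‖ ^ 2 := by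
    intro n k h
    have h1 := hinner n (c k) (hanti h (hcm k))
    have h2 := norm_sub_sq_real (c k) (c n)
    rw [real_inner_comm] at h2
    linarith
  have hmono : Monotone fun n => ‖c n‖ ^ 2 := by
    intro n k h
    have := hsq h
    have h0 : 0 ≤ ‖c k - c n‖ ^ 2 := by positivity
    show ‖c n‖ ^ 2 ≤ ‖c k‖ ^ 2
    linarith
  have hbdd : ∀ n, ‖c n‖ ^ 2 ≤ R ^ 2 := by
    intro n
    have hball : C n ⊆ Metric.closedBall 0 R := by
      refine closure_minimal (convexHull_min ?_ (convex_closedBall 0 R)) Metric.isClosed_closedBall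
      rintro _ ⟨k, -, rfl⟩
      simpa using hu k
    have := hball (hcm n)
    rw [mem_closedBall_zero_iff] at this
    gcongr
  have hlim := tendsto_atTop_ciSup hmono ⟨R ^ 2, by rintro _ ⟨n, rfl⟩; exact hbdd n⟩
  have hcauchy : CauchySeq c := by
    rw [Metric.cauchySeq_iff']
    intro ε hε
    obtain ⟨N, hN⟩ := Metric.cauchySeq_iff'.1 hlim.cauchySeq (ε ^ 2) (by positivity)
    refine ⟨N, fun n hn => ?_⟩
    have h1 := hN n hn
    rw [Real.dist_eq] at h1
    have h2 := (hsq hn).trans (le_abs_self _)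
    rw [dist_eq_norm]
    exact lt_of_pow_lt_pow_left₀ 2 hε.le (h2.trans_lt h1)
  obtain ⟨h, hh⟩ := cauchySeq_tendsto_of_complete hcauchy
  choose w hwm hw using fun n => Metric.mem_closure_iff.1 (hcm n)
    (1 / ((n : ℝ) + 1)) (by positivity)
  refine ⟨w, h, hwm, ?_⟩
  refine hh.congr_dist ?_
  refine squeeze_zero (fun _ => dist_nonneg) (fun n => (hw n).le) ?_
  exact tendsto_one_div_add_atTop_nhds_zero_nat

/-- Function-level form in `L²`: convex combinations of the tails of a bounded sequence converge
almost everywhere and in `L²`. The sequence lives in a vector space mapped linearly to functions. -/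
theorem exists_tendsto_ae_convexHull_tail {α E V : Type*} [MeasurableSpace α] {μ : Measure α}
    [NormedAddCommGroup E] [InnerProductSpace ℝ E] [CompleteSpace E] [AddCommGroup V] [Module ℝ V]
    (T : V →ₗ[ℝ] α → E) (u : ℕ → V) (hu : ∀ n, MemLp (T (u n)) 2 μ) (R : ℝ≥0)
    (hR : ∀ n, eLpNorm (T (u n)) 2 μ ≤ R) :
    ∃ w : ℕ → V, ∃ h : α → E, (∀ n, w n ∈ convexHull ℝ (u '' Ici n)) ∧ MemLp h 2 μ ∧
      (∀ᵐ x ∂μ, Tendsto (fun n => T (w n) x) atTop (𝓝 (h x))) ∧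
      Tendsto (fun n => eLpNorm (T (w n) - h) 2 μ) atTop (𝓝 0) := by
  obtain ⟨W, h, hW, hWh⟩ := exists_tendsto_convexHull_tail (fun n => (hu n).toLp (T (u n))) R (by
    intro n
    rw [Lp.norm_toLp]
    exact ENNReal.toReal_le_of_le_ofReal R.2 (by simpa using hR n))
  have hlift : ∀ n, ∃ w ∈ convexHull ℝ (u '' Ici n), W n =ᵐ[μ] T w := by
    intro n
    have hsub : convexHull ℝ ((fun n => (hu n).toLp (T (u n))) '' Ici n) ⊆
        {F | ∃ w ∈ convexHull ℝ (u '' Ici n), F =ᵐ[μ] T w} := by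
      refine convexHull_min ?_ ?_
      · rintro _ ⟨k, hk, rfl⟩
        exact ⟨u k, subset_convexHull ℝ _ ⟨k, hk, rfl⟩, (hu k).coeFn_toLp⟩
      · rintro F ⟨a, ha, hFa⟩ G ⟨b, hb, hGb⟩ s t hs ht hst
        refine ⟨s • a + t • b, convex_convexHull ℝ _ ha hb hs ht hst, ?_⟩
        filter_upwards [hFa, hGb, Lp.coeFn_add (s • F) (t • G), Lp.coeFn_smul s F,
          Lp.coeFn_smul t G] with x h1 h2 h3 h4 h5
        rw [h3, Pi.add_apply, h4, h5]
        simp [h1, h2]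
    exact hsub (hW n)
  choose w hw hWw using hlift
  -- Almost everywhere convergence costs a subsequence, but `ns k ≥ k`, so the `k`-th term still
  -- belongs to the hull of the `k`-th tail.
  obtain ⟨ns, hns, hae⟩ := (tendstoInMeasure_of_tendsto_Lp hWh).exists_seq_tendsto_ae
  refine ⟨fun k => w (ns k), h, fun k => ?_, Lp.memLp h, ?_, ?_⟩
  · exact convexHull_mono (image_mono (Ici_subset_Ici.2 (hns.id_le k))) (hw (ns k))
  · filter_upwards [hae, ae_all_iff.2 fun n => hWw n] with x h1 h2
    simpa only [h2] using h1
  · have := (Lp.tendsto_Lp_iff_tendsto_eLpNorm' _ _).1 (hWh.comp hns.tendsto_atTop)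
    refine this.congr fun k => eLpNorm_congr_ae ?_
    filter_upwards [hWw (ns k)] with x hx
    simp [hx]

/-! ### Columns of linear maps and calculus of weak gradients -/

section

variable {d m : ℕ}

/-- A linear map between Euclidean spaces, as the vector of its columns. -/
noncomputable def colLinearEquiv (d m : ℕ) :
    (EucSp d →L[ℝ] EucSp m) ≃ₗ[ℝ] PiLp 2 (fun _ : Fin d => EucSp m) where
  toFun A := WithLp.toLp 2 fun i => A (EuclideanSpace.single i 1)
  map_add' A B := by ext i; simp
  map_smul' a A := by ext i; simp
  invFun w := ∑ i, (EuclideanSpace.proj i : EucSp d →L[ℝ] ℝ).smulRight (w i)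
  left_inv A := by
    ext1 x
    conv_rhs => rw [← (EuclideanSpace.basisFun (Fin d) ℝ).sum_repr x]
    simp [map_sum]
  right_inv w := by
    ext i : 1
    simp [ite_smul]

/-- A linear map between Euclidean spaces, as the vector of its columns. -/
noncomputable def colEquiv (d m : ℕ) :
    (EucSp d →L[ℝ] EucSp m) ≃L[ℝ] PiLp 2 (fun _ : Fin d => EucSp m) :=
  { colLinearEquiv d m with
    continuous_toFun := (PiLp.continuous_toLp 2 _).comp
      (continuous_pi fun i => (ContinuousLinearMap.apply ℝ (EucSp m)
        (EuclideanSpace.single i (1 : ℝ))).continuous)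
    continuous_invFun := by
      have h : ∀ i : Fin d, Continuous fun w : PiLp 2 (fun _ : Fin d => EucSp m) =>
          (EuclideanSpace.proj i : EucSp d →L[ℝ] ℝ).smulRight (w i) := fun i =>
        ((ContinuousLinearMap.smulRightL ℝ (EucSp d) (EucSp m)
          (EuclideanSpace.proj i : EucSp d →L[ℝ] ℝ)).continuous).comp
          ((continuous_apply i).comp (PiLp.continuous_ofLp 2 _))
      exact continuous_finsetSum Finset.univ fun i _ => h i }

theorem colEquiv_apply (A : EucSp d →L[ℝ] EucSp m) (i : Fin d) :
    colEquiv d m A i = A (EuclideanSpace.single i 1) := rfl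

/-- This places gradients in a Hilbert space without changing the seminorm, which is what the
least-norm argument requires. -/
theorem hsNorm_eq_norm_colEquiv (A : EucSp d →L[ℝ] EucSp m) : hsNorm A = ‖colEquiv d m A‖ := by
  rw [PiLp.norm_eq_of_L2]
  simp only [hsNorm, colEquiv_apply]

theorem integrable_smul_of_tsupport_subset {E F : Type*} [TopologicalSpace E] [T2Space E]
    [MeasurableSpace E]
    [OpensMeasurableSpace E] [NormedAddCommGroup F] [NormedSpace ℝ F] {μ : Measure E} {Ω : Set E}
    {φ : E → ℝ} {f : E → F} (hf : LocallyIntegrableOn f Ω μ) (hφ : Continuous φ)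
    (hcs : HasCompactSupport φ) (hsub : tsupport φ ⊆ Ω) :
    Integrable (fun x => φ x • f x) (μ.restrict Ω) := by
  have h1 : IntegrableOn f (tsupport φ) μ := hf.integrableOn_compact_subset hsub hcs
  have h2 : IntegrableOn (fun x => φ x • f x) (tsupport φ) μ :=
    h1.continuousOn_smul hφ.continuousOn hcs
  refine Integrable.restrict ((integrableOn_iff_integrable_of_support_subset ?_).1 h2)
  intro x hx
  refine subset_tsupport φ fun h0 => hx ?_
  simp [h0]

theorem HasCompactSupport.fderiv_apply_const {φ : EucSp d → ℝ} (hcs : HasCompactSupport φ)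
    (v : EucSp d) : HasCompactSupport fun x => fderiv ℝ φ x v :=
  hcs.fderiv_apply ℝ v

theorem tsupport_fderiv_apply_const_subset (φ : EucSp d → ℝ) (v : EucSp d) :
    tsupport (fun x => fderiv ℝ φ x v) ⊆ tsupport φ :=
  tsupport_fderiv_apply_subset ℝ v

theorem ContDiff.continuous_fderiv_apply_const {φ : EucSp d → ℝ}
    (hφ : ContDiff ℝ (⊤ : ℕ∞) φ) (v : EucSp d) : Continuous fun x => fderiv ℝ φ x v :=
  (hφ.continuous_fderiv (by simp)).clm_apply continuous_const

namespace HasWeakGrad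

variable {Ω : Set (EucSp d)} {f f' : EucSp d → EucSp m} {G G' : EucSp d → EucSp d →L[ℝ] EucSp m}

theorem congr (h : HasWeakGrad Ω f G) (hf : f =ᵐ[volume.restrict Ω] f')
    (hG : G =ᵐ[volume.restrict Ω] G') : HasWeakGrad Ω f' G' := by
  refine ⟨h.1.congr hf, h.2.1.congr hG, fun φ hφ hcs hsub v => ?_⟩
  have h1 : ∫ x in Ω, (fderiv ℝ φ x v) • f' x = ∫ x in Ω, (fderiv ℝ φ x v) • f x :=
    integral_congr_ae (by filter_upwards [hf] with x hx; rw [hx])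
  have h2 : ∫ x in Ω, φ x • G' x v = ∫ x in Ω, φ x • G x v :=
    integral_congr_ae (by filter_upwards [hG] with x hx; rw [hx])
  rw [h1, h2, h.2.2 φ hφ hcs hsub v]

theorem integrable_fderiv_smul (h : HasWeakGrad Ω f G) {φ : EucSp d → ℝ}
    (hφ : ContDiff ℝ (⊤ : ℕ∞) φ) (hcs : HasCompactSupport φ) (hsub : tsupport φ ⊆ Ω)
    (v : EucSp d) : Integrable (fun x => (fderiv ℝ φ x v) • f x) (volume.restrict Ω) :=
  integrable_smul_of_tsupport_subset h.1 (hφ.continuous_fderiv_apply_const v)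
    (hcs.fderiv_apply_const v) ((tsupport_fderiv_apply_const_subset φ v).trans hsub)

theorem integrable_smul_grad (h : HasWeakGrad Ω f G) {φ : EucSp d → ℝ}
    (hφ : Continuous φ) (hcs : HasCompactSupport φ) (hsub : tsupport φ ⊆ Ω) :
    Integrable (fun x => φ x • G x) (volume.restrict Ω) :=
  integrable_smul_of_tsupport_subset h.2.1 hφ hcs hsub

theorem integrable_smul_grad_apply (h : HasWeakGrad Ω f G) {φ : EucSp d → ℝ}
    (hφ : Continuous φ) (hcs : HasCompactSupport φ) (hsub : tsupport φ ⊆ Ω) (v : EucSp d) :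
    Integrable (fun x => φ x • G x v) (volume.restrict Ω) := by
  simpa using (h.integrable_smul_grad hφ hcs hsub).apply_continuousLinearMap v

theorem aestronglyMeasurable (h : HasWeakGrad Ω f G) :
    AEStronglyMeasurable G (volume.restrict Ω) :=
  h.2.1.aestronglyMeasurable

/-- Weak gradients are unique up to null sets. -/
theorem ae_eq (hΩ : IsOpen Ω) (h : HasWeakGrad Ω f G) (h' : HasWeakGrad Ω f G') :
    G =ᵐ[volume.restrict Ω] G' := by
  have hloc : LocallyIntegrableOn (G - G') Ω (volume.restrict Ω) := by
    intro x hx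
    obtain ⟨s, hs, hi⟩ := (h.2.1.sub h'.2.1) x hx
    exact ⟨s, hs, hi.mono_measure Measure.restrict_le_self⟩
  have key := hΩ.ae_eq_zero_of_integral_contDiff_smul_eq_zero hloc (by
    intro φ hφ hcs hsub
    have hi := h.integrable_smul_grad hφ.continuous hcs hsub
    have hi' := h'.integrable_smul_grad hφ.continuous hcs hsub
    simp only [Pi.sub_apply, smul_sub]
    rw [integral_sub hi hi', sub_eq_zero]
    ext1 v
    rw [ContinuousLinearMap.integral_apply hi, ContinuousLinearMap.integral_apply hi']
    have e1 := h.2.2 φ hφ hcs hsub v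
    rw [h'.2.2 φ hφ hcs hsub v, neg_inj] at e1
    simpa using e1.symm)
  filter_upwards [key, ae_restrict_mem hΩ.measurableSet] with x hx hxΩ
  exact sub_eq_zero.1 (hx hxΩ)

theorem combo (h : HasWeakGrad Ω f G) (h' : HasWeakGrad Ω f' G') (a b : ℝ) :
    HasWeakGrad Ω (a • f + b • f') (a • G + b • G') := by
  refine ⟨(h.1.smul a).add (h'.1.smul b), (h.2.1.smul a).add (h'.2.1.smul b),
    fun φ hφ hcs hsub v => ?_⟩
  have e1 : ∀ x, (fderiv ℝ φ x v) • (a • f + b • f') x =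
      a • ((fderiv ℝ φ x v) • f x) + b • ((fderiv ℝ φ x v) • f' x) := by
    intro x
    simp only [Pi.add_apply, Pi.smul_apply, smul_add]
    rw [smul_comm a, smul_comm b]
  have e2 : ∀ x, φ x • (a • G + b • G') x v = a • (φ x • G x v) + b • (φ x • G' x v) := by
    intro x
    simp only [Pi.add_apply, Pi.smul_apply, add_apply,
      smul_apply, smul_add]
    rw [smul_comm a, smul_comm b]
  simp_rw [e1, e2]
  have i1 : Integrable (fun x => a • (fderiv ℝ φ x v) • f x) (volume.restrict Ω) :=
    (h.integrable_fderiv_smul hφ hcs hsub v).smul a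
  have i2 : Integrable (fun x => b • (fderiv ℝ φ x v) • f' x) (volume.restrict Ω) :=
    (h'.integrable_fderiv_smul hφ hcs hsub v).smul b
  have i3 : Integrable (fun x => a • φ x • G x v) (volume.restrict Ω) :=
    (h.integrable_smul_grad_apply hφ.continuous hcs hsub v).smul a
  have i4 : Integrable (fun x => b • φ x • G' x v) (volume.restrict Ω) :=
    (h'.integrable_smul_grad_apply hφ.continuous hcs hsub v).smul b
  rw [integral_add i1 i2, integral_add i3 i4]
  simp only [integral_smul]
  rw [h.2.2 φ hφ hcs hsub v, h'.2.2 φ hφ hcs hsub v]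
  simp only [smul_neg, neg_add]

theorem weakGrad_ae_eq (hΩ : IsOpen Ω) (h : HasWeakGrad Ω f G) :
    weakGrad Ω f =ᵐ[volume.restrict Ω] G := by
  have hex : ∃ G, HasWeakGrad Ω f G := ⟨G, h⟩
  have : HasWeakGrad Ω f (weakGrad Ω f) := by
    rw [weakGrad, dif_pos hex]
    exact hex.choose_spec
  exact this.ae_eq hΩ h

end HasWeakGrad

/-! ### The marginal on `X` -/

section Marginal

variable {X : Set (EucSp d)} {σ : Measure (EucSp d × EucSp m)} {Y : Set (EucSp m)}

/-- The frontier of a convex set is Lebesgue null, so the marginal does not charge it and weak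
gradients, known only in the interior, are determined almost everywhere for the marginal. -/
theorem fst_absolutelyContinuous_interior (hX : IsCompact X) (hXc : Convex ℝ X)
    (hσXY : σ (X ×ˢ Y)ᶜ = 0) (hσac : σ ≪ volume) :
    σ.fst ≪ volume.restrict (interior X) := by
  have h1 : σ.fst ≪ volume := by
    refine Measure.AbsolutelyContinuous.mk fun s hs h0 => ?_
    rw [Measure.fst_apply hs]
    apply hσac
    rw [show (Prod.fst ⁻¹' s : Set (EucSp d × EucSp m)) = s ×ˢ univ by ext; simp,
      Measure.volume_eq_prod, Measure.prod_prod, h0, zero_mul]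
  have h2 : σ.fst Xᶜ = 0 := by
    rw [Measure.fst_apply hX.measurableSet.compl]
    refine measure_mono_null ?_ hσXY
    intro z hz hz'
    exact hz hz'.1
  have h3 : σ.fst (interior X)ᶜ = 0 := by
    have : (interior X)ᶜ ⊆ Xᶜ ∪ frontier X := by
      intro x hx
      by_cases hxX : x ∈ X
      · exact Or.inr ⟨subset_closure hxX, hx⟩
      · exact Or.inl hxX
    exact measure_mono_null this (measure_union_null h2 (h1 (hXc.addHaar_frontier volume)))
  refine Measure.AbsolutelyContinuous.mk fun s hs h0 => ?_
  rw [Measure.restrict_apply hs] at h0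
  refine measure_mono_null ?_ (measure_union_null (h1 h0) h3)
  intro x hx
  by_cases hxX : x ∈ interior X
  · exact Or.inl ⟨hx, hxX⟩
  · exact Or.inr hxX

theorem interior_nonempty_of_absolutelyContinuous {μ : Measure (EucSp d)} [IsProbabilityMeasure μ]
    (hμ : μ ≪ volume.restrict (interior X)) : (interior X).Nonempty := by
  by_contra h
  rw [not_nonempty_iff_eq_empty] at h
  rw [h, Measure.restrict_empty] at hμ
  have := hμ (s := univ) rfl
  simp at this

end Marginal

/-! ### Convexity and closedness of the admissible pairs -/

/-- The standing assumptions on the data: compact convex domains, a marginal equivalent to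
Lebesgue measure on `X` with density bounded below, and a continuous loss that is convex in its
first argument. -/
structure IsRegularProblem (X : Set (EucSp d)) (Y : Set (EucSp m))
    (σ : Measure (EucSp d × EucSp m)) (ℓ : EucSp m → EucSp m → ℝ) : Prop where
  compact_left : IsCompact X
  convex_left : Convex ℝ X
  compact_right : IsCompact Y
  convex_right : Convex ℝ Y
  ae_mem : ∀ᵐ z ∂σ, z.1 ∈ X ∧ z.2 ∈ Y
  fst_ac : σ.fst ≪ volume.restrict (interior X)
  lower_bound : ∃ C : ℝ≥0, volume.restrict (interior X) ≤ C • σ.fst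
  loss_convex : ∀ b ∈ Y, ConvexOn ℝ Y (fun a => ℓ a b)
  loss_continuous : ContinuousOn (fun z : EucSp m × EucSp m => ℓ z.1 z.2) (Y ×ˢ Y)

/-- Pairs of a map `X → Y` and a weak gradient of it, with expected loss at most `L`. -/
def admissiblePairs (X : Set (EucSp d)) (Y : Set (EucSp m))
    (σ : Measure (EucSp d × EucSp m)) (ℓ : EucSp m → EucSp m → ℝ) (L : ℝ) :
    Set ((EucSp d → EucSp m) × (EucSp d → EucSp d →L[ℝ] EucSp m)) :=
  {q | MapsTo q.1 X Y ∧ AEStronglyMeasurable q.1 σ.fst ∧ HasWeakGrad (interior X) q.1 q.2 ∧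
    expectedLoss σ ℓ q.1 ≤ L}

namespace IsRegularProblem

variable {X : Set (EucSp d)} {Y : Set (EucSp m)} {σ : Measure (EucSp d × EucSp m)}
  {ℓ : EucSp m → EucSp m → ℝ}

theorem ac_fst (h : IsRegularProblem X Y σ ℓ) : volume.restrict (interior X) ≪ σ.fst := by
  obtain ⟨C, hC⟩ := h.lower_bound
  exact (Measure.absolutelyContinuous_of_le hC).trans Measure.smul_absolutelyContinuous

theorem ae_fst_mem_interior (h : IsRegularProblem X Y σ ℓ) : ∀ᵐ x ∂σ.fst, x ∈ interior X :=
  h.fst_ac.ae_le (ae_restrict_mem isOpen_interior.measurableSet)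

theorem ae_fst_mem (h : IsRegularProblem X Y σ ℓ) : ∀ᵐ x ∂σ.fst, x ∈ X :=
  h.ae_fst_mem_interior.mono fun _ hx => interior_subset hx

theorem ae_of_ae_fst {p : EucSp d → Prop} (hp : ∀ᵐ x ∂σ.fst, p x) : ∀ᵐ z ∂σ, p z.1 :=
  ae_of_ae_map measurable_fst.aemeasurable hp

theorem exists_norm_le (h : IsRegularProblem X Y σ ℓ) :
    ∃ R : ℝ, 0 ≤ R ∧ ∀ f : EucSp d → EucSp m, MapsTo f X Y → ∀ x ∈ X, ‖f x‖ ≤ R := by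
  obtain ⟨R, hR⟩ := h.compact_right.isBounded.exists_norm_le
  exact ⟨max R 0, le_max_right _ _, fun f hf x hx => (hR _ (hf hx)).trans (le_max_left _ _)⟩

theorem aestronglyMeasurable_loss (h : IsRegularProblem X Y σ ℓ) {f : EucSp d → EucSp m}
    (hf : MapsTo f X Y) (hfm : AEStronglyMeasurable f σ.fst) :
    AEStronglyMeasurable (fun z => ℓ (f z.1) z.2) σ := by
  classical
  have hY : MeasurableSet (Y ×ˢ Y) :=
    h.compact_right.measurableSet.prod h.compact_right.measurableSet
  -- The loss is controlled on `Y ×ˢ Y` only; its extension by zero is Borel and agrees with it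
  -- along almost every sample.
  have hmeas : Measurable ((Y ×ˢ Y).piecewise (fun z : EucSp m × EucSp m => ℓ z.1 z.2)
      fun _ => 0) := h.loss_continuous.measurable_piecewise continuousOn_const hY
  have hpair : AEMeasurable (fun z : EucSp d × EucSp m => (f z.1, z.2)) σ :=
    (hfm.aemeasurable.comp_measurable measurable_fst).prodMk measurable_snd.aemeasurable
  refine ((hmeas.comp_aemeasurable hpair).congr ?_).aestronglyMeasurable
  filter_upwards [h.ae_mem] with z hz
  simp [hf hz.1, hz.2]

theorem exists_loss_bound (h : IsRegularProblem X Y σ ℓ) :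
    ∃ B : ℝ, ∀ f : EucSp d → EucSp m, MapsTo f X Y → ∀ᵐ z ∂σ, ‖ℓ (f z.1) z.2‖ ≤ B := by
  obtain ⟨B, hB⟩ := (h.compact_right.prod h.compact_right).exists_bound_of_continuousOn
    h.loss_continuous
  refine ⟨B, fun f hf => ?_⟩
  filter_upwards [h.ae_mem] with z hz
  exact hB (f z.1, z.2) ⟨hf hz.1, hz.2⟩

theorem integrable_loss [IsFiniteMeasure σ] (h : IsRegularProblem X Y σ ℓ) {f : EucSp d → EucSp m}
    (hf : MapsTo f X Y) (hfm : AEStronglyMeasurable f σ.fst) :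
    Integrable (fun z => ℓ (f z.1) z.2) σ := by
  obtain ⟨B, hB⟩ := h.exists_loss_bound
  exact Integrable.of_bound (h.aestronglyMeasurable_loss hf hfm) B (hB f hf)

theorem expectedLoss_combo_le [IsFiniteMeasure σ] (h : IsRegularProblem X Y σ ℓ)
    {f f' : EucSp d → EucSp m} (hf : MapsTo f X Y) (hfm : AEStronglyMeasurable f σ.fst)
    (hf' : MapsTo f' X Y) (hfm' : AEStronglyMeasurable f' σ.fst) {a b : ℝ}
    (ha : 0 ≤ a) (hb : 0 ≤ b) (hab : a + b = 1) :
    expectedLoss σ ℓ (a • f + b • f') ≤ a * expectedLoss σ ℓ f + b * expectedLoss σ ℓ f' := by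
  have i1 := (h.integrable_loss hf hfm).const_mul a
  have i2 := (h.integrable_loss hf' hfm').const_mul b
  simp only [expectedLoss]
  rw [← integral_const_mul, ← integral_const_mul, ← integral_add i1 i2]
  refine integral_mono_ae (h.integrable_loss ?_ ((hfm.const_smul a).add (hfm'.const_smul b)))
    (i1.add i2) ?_
  · exact fun x hx => h.convex_right (hf hx) (hf' hx) ha hb hab
  · filter_upwards [h.ae_mem] with z hz
    exact (h.loss_convex z.2 hz.2).2 (hf hz.1) (hf' hz.1) ha hb hab

theorem tendsto_expectedLoss [IsFiniteMeasure σ] (h : IsRegularProblem X Y σ ℓ)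
    {F : ℕ → EucSp d → EucSp m} {f : EucSp d → EucSp m} (hF : ∀ n, MapsTo (F n) X Y)
    (hFm : ∀ n, AEStronglyMeasurable (F n) σ.fst) (hf : MapsTo f X Y)
    (hlim : ∀ᵐ x ∂σ.fst, Tendsto (fun n => F n x) atTop (𝓝 (f x))) :
    Tendsto (fun n => expectedLoss σ ℓ (F n)) atTop (𝓝 (expectedLoss σ ℓ f)) := by
  obtain ⟨B, hB⟩ := h.exists_loss_bound
  refine tendsto_integral_of_dominated_convergence (fun _ => B)
    (fun n => h.aestronglyMeasurable_loss (hF n) (hFm n)) (integrable_const B)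
    (fun n => hB _ (hF n)) ?_
  filter_upwards [h.ae_mem, ae_of_ae_fst hlim] with z hz hl
  have hc := h.loss_continuous (f z.1, z.2) ⟨hf hz.1, hz.2⟩
  refine hc.tendsto.comp (tendsto_nhdsWithin_iff.2 ⟨hl.prodMk_nhds tendsto_const_nhds, ?_⟩)
  exact Eventually.of_forall fun n => ⟨hF n hz.1, hz.2⟩

theorem aestronglyMeasurable_grad (h : IsRegularProblem X Y σ ℓ) {f : EucSp d → EucSp m}
    {G : EucSp d → EucSp d →L[ℝ] EucSp m} (hG : HasWeakGrad (interior X) f G) :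
    AEStronglyMeasurable G σ.fst :=
  hG.aestronglyMeasurable.mono_ac h.fst_ac

theorem aestronglyMeasurable_colEquiv (h : IsRegularProblem X Y σ ℓ) {f : EucSp d → EucSp m}
    {G : EucSp d → EucSp d →L[ℝ] EucSp m} (hG : HasWeakGrad (interior X) f G) :
    AEStronglyMeasurable (fun x => colEquiv d m (G x)) σ.fst :=
  (colEquiv d m).continuous.comp_aestronglyMeasurable (h.aestronglyMeasurable_grad hG)

theorem convex_admissiblePairs [IsFiniteMeasure σ] (h : IsRegularProblem X Y σ ℓ) (L : ℝ) :
    Convex ℝ (admissiblePairs X Y σ ℓ L) := by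
  rintro ⟨f, G⟩ ⟨hf1, hf2, hf3, hf4⟩ ⟨f', G'⟩ ⟨hf1', hf2', hf3', hf4'⟩ a b ha hb hab
  refine ⟨fun x hx => h.convex_right (hf1 hx) (hf1' hx) ha hb hab,
    (hf2.const_smul a).add (hf2'.const_smul b), hf3.combo hf3' a b, ?_⟩
  refine (h.expectedLoss_combo_le hf1 hf2 hf1' hf2' ha hb hab).trans ?_
  calc a * expectedLoss σ ℓ f + b * expectedLoss σ ℓ f' ≤ a * L + b * L := by gcongr
    _ = L := by rw [← add_mul, hab, one_mul]

/-- Minkowski's inequality, whence `1 ≤ p`. It keeps convex combinations of a tail below the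
seminorm bound of that tail. -/
theorem convex_admissiblePairs_sublevel [IsFiniteMeasure σ] (h : IsRegularProblem X Y σ ℓ) (L : ℝ)
    {p : ℝ≥0∞} (hp : 1 ≤ p) (V : ℝ≥0∞) :
    Convex ℝ {q | q ∈ admissiblePairs X Y σ ℓ L ∧
      eLpNorm (fun x => colEquiv d m (q.2 x)) p σ.fst ≤ V} := by
  rintro ⟨f, G⟩ ⟨hf, hV⟩ ⟨f', G'⟩ ⟨hf', hV'⟩ a b ha hb hab
  refine ⟨h.convex_admissiblePairs L hf hf' ha hb hab, ?_⟩
  have m1 := h.aestronglyMeasurable_colEquiv hf.2.2.1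
  have m2 := h.aestronglyMeasurable_colEquiv hf'.2.2.1
  have e : (fun x => colEquiv d m ((a • (f, G) + b • (f', G')).2 x)) =
      (a • fun x => colEquiv d m (G x)) + b • fun x => colEquiv d m (G' x) := by
    funext x
    simp
  rw [e]
  refine (eLpNorm_add_le (m1.const_smul a) (m2.const_smul b) hp).trans ?_
  rw [eLpNorm_const_smul, eLpNorm_const_smul]
  calc ‖a‖ₑ * eLpNorm (fun x => colEquiv d m (G x)) p σ.fst +
        ‖b‖ₑ * eLpNorm (fun x => colEquiv d m (G' x)) p σ.fst ≤ ‖a‖ₑ * V + ‖b‖ₑ * V := by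
        gcongr
    _ = V := by
        rw [← add_mul, Real.enorm_eq_ofReal ha, Real.enorm_eq_ofReal hb, ← ENNReal.ofReal_add ha hb,
          hab, ENNReal.ofReal_one, one_mul]

theorem integrable_restrict_of_integrable_fst (h : IsRegularProblem X Y σ ℓ) {F : Type*}
    [NormedAddCommGroup F] {g : EucSp d → F} (hg : Integrable g σ.fst) :
    Integrable g (volume.restrict (interior X)) := by
  obtain ⟨C, hC⟩ := h.lower_bound
  exact Integrable.of_measure_le_smul (c := C) (by simp) hC hg

theorem isFiniteMeasure_restrict (h : IsRegularProblem X Y σ ℓ) :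
    IsFiniteMeasure (volume.restrict (interior X)) :=
  ⟨by
    rw [Measure.restrict_apply_univ]
    exact (measure_mono interior_subset).trans_lt h.compact_left.measure_lt_top⟩

theorem integrable_restrict_of_mapsTo (h : IsRegularProblem X Y σ ℓ) {f : EucSp d → EucSp m}
    (hf : MapsTo f X Y) (hfm : AEStronglyMeasurable f σ.fst) :
    Integrable f (volume.restrict (interior X)) := by
  have := h.isFiniteMeasure_restrict
  obtain ⟨R, -, hR⟩ := h.exists_norm_le
  refine Integrable.of_bound (hfm.mono_ac h.ac_fst) R ?_
  filter_upwards [ae_restrict_mem isOpen_interior.measurableSet] with x hx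
  exact hR f hf x (interior_subset hx)

/-- The admissible pairs are closed under almost everywhere convergence of the maps together with
`L¹` convergence of the weak gradients. -/
theorem mem_admissiblePairs_of_tendsto [IsFiniteMeasure σ] (h : IsRegularProblem X Y σ ℓ) {L : ℝ}
    {q : ℕ → (EucSp d → EucSp m) × (EucSp d → EucSp d →L[ℝ] EucSp m)}
    (hq : ∀ n, q n ∈ admissiblePairs X Y σ ℓ L) {f : EucSp d → EucSp m}
    {G : EucSp d → EucSp d →L[ℝ] EucSp m} (hf : MapsTo f X Y)
    (hlim : ∀ᵐ x ∂σ.fst, Tendsto (fun n => (q n).1 x) atTop (𝓝 (f x)))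
    (hG : Integrable G σ.fst)
    (hGlim : Tendsto (fun n => eLpNorm ((q n).2 - G) 1 σ.fst) atTop (𝓝 0)) :
    (f, G) ∈ admissiblePairs X Y σ ℓ L := by
  have hfm : AEStronglyMeasurable f σ.fst :=
    aestronglyMeasurable_of_tendsto_ae atTop (fun n => (hq n).2.1) hlim
  have hfi := h.integrable_restrict_of_mapsTo hf hfm
  have hGi := h.integrable_restrict_of_integrable_fst hG
  obtain ⟨R, hR0, hR⟩ := h.exists_norm_le
  obtain ⟨C, hC⟩ := h.lower_bound
  -- The lower bound on the density carries `L¹` convergence over to Lebesgue measure, where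
  -- integration by parts takes place.
  have hGlim' : Tendsto (fun n => eLpNorm ((q n).2 - G) 1 (volume.restrict (interior X)))
      atTop (𝓝 0) := by
    have h0 : Tendsto (fun n => C • eLpNorm ((q n).2 - G) 1 σ.fst) atTop (𝓝 0) := by
      have := ENNReal.Tendsto.const_mul hGlim (a := C) (Or.inr (by simp))
      simpa [ENNReal.smul_def] using this
    refine tendsto_of_tendsto_of_tendsto_of_le_of_le tendsto_const_nhds h0 (fun _ => zero_le)
      fun n => ?_
    refine (eLpNorm_mono_measure _ hC).trans ?_
    rw [eLpNorm_one_eq_lintegral_enorm, eLpNorm_one_eq_lintegral_enorm, lintegral_smul_measure]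
  refine ⟨hf, hfm, ⟨IntegrableOn.locallyIntegrableOn hfi, IntegrableOn.locallyIntegrableOn hGi,
    fun φ hφ hcs hsub v => ?_⟩, ?_⟩
  · have hleft : Tendsto (fun n => ∫ x in interior X, (fderiv ℝ φ x v) • (q n).1 x) atTop
        (𝓝 (∫ x in interior X, (fderiv ℝ φ x v) • f x)) := by
      have hφi : Integrable (fun x => fderiv ℝ φ x v) (volume.restrict (interior X)) :=
        ((hφ.continuous_fderiv_apply_const v).integrable_of_hasCompactSupport
          (hcs.fderiv_apply_const v)).restrict
      refine tendsto_integral_of_dominated_convergence (fun x => ‖fderiv ℝ φ x v‖ * R)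
        (fun n => ((hq n).2.2.1.integrable_fderiv_smul hφ hcs hsub v).aestronglyMeasurable)
        (hφi.norm.mul_const R) (fun n => ?_) ?_
      · filter_upwards [ae_restrict_mem isOpen_interior.measurableSet] with x hx
        rw [norm_smul]
        gcongr
        exact hR _ (hq n).1 x (interior_subset hx)
      · filter_upwards [h.ac_fst.ae_le hlim] with x hx
        exact hx.const_smul _
    have hright : Tendsto (fun n => ∫ x in interior X, φ x • (q n).2 x v) atTop
        (𝓝 (∫ x in interior X, φ x • G x v)) := by
      obtain ⟨M, hM⟩ := hcs.exists_bound_of_continuous hφ.continuous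
      have hM0 : 0 ≤ M := (norm_nonneg _).trans (hM 0)
      refine tendsto_integral_of_L1 _ ?_ (Eventually.of_forall fun n =>
        (hq n).2.2.1.integrable_smul_grad_apply hφ.continuous hcs hsub v) ?_
      · exact hφ.continuous.aestronglyMeasurable.smul
          (hGi.aestronglyMeasurable.apply_continuousLinearMap v)
      · have h0 : Tendsto (fun n => ENNReal.ofReal (M * ‖v‖) *
            eLpNorm ((q n).2 - G) 1 (volume.restrict (interior X))) atTop (𝓝 0) := by
          have := ENNReal.Tendsto.const_mul hGlim' (a := ENNReal.ofReal (M * ‖v‖))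
            (Or.inr (by simp))
          simpa using this
        refine tendsto_of_tendsto_of_tendsto_of_le_of_le tendsto_const_nhds h0 (fun _ => zero_le)
          fun n => ?_
        simp only
        rw [← eLpNorm_one_eq_lintegral_enorm]
        refine eLpNorm_le_mul_eLpNorm_of_ae_le_mul (Eventually.of_forall fun x => ?_) 1
        rw [← smul_sub, norm_smul, mul_assoc]
        gcongr
        · exact hM x
        · rw [mul_comm]
          simpa using (((q n).2 - G) x).le_opNorm v
    refine tendsto_nhds_unique hleft ?_
    refine hright.neg.congr fun n => ?_
    exact ((hq n).2.2.1.2.2 φ hφ hcs hsub v).symm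
  · exact le_of_tendsto (h.tendsto_expectedLoss (fun n => (hq n).1) (fun n => (hq n).2.1) hf hlim)
      (Eventually.of_forall fun n => (hq n).2.2.2)

end IsRegularProblem

/-! ### Compactness of admissible pairs -/

/-- A map together with its gradient, as a map into a Euclidean space. -/
noncomputable def mapGradVec (d m : ℕ) :
    ((EucSp d → EucSp m) × (EucSp d → EucSp d →L[ℝ] EucSp m)) →ₗ[ℝ]
      EucSp d → WithLp 2 (EucSp m × PiLp 2 (fun _ : Fin d => EucSp m)) where
  toFun q := fun x => WithLp.toLp 2 (q.1 x, colEquiv d m (q.2 x))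
  map_add' q q' := by funext x; simp; rfl
  map_smul' a q := by funext x; simp; rfl

namespace IsRegularProblem

variable {X : Set (EucSp d)} {Y : Set (EucSp m)} {σ : Measure (EucSp d × EucSp m)}
  {ℓ : EucSp m → EucSp m → ℝ}

/-- The norm of the pair is at most the sum of the two norms, so `R` is the bound for maps into `Y`
plus `V`, independent of the pair. Joining map and gradient in one vector lets the same convex
combinations serve both. -/
theorem memLp_mapGradVec [IsProbabilityMeasure σ] (h : IsRegularProblem X Y σ ℓ) {L : ℝ}
    {V : ℝ≥0∞} (hV : V ≠ ∞) :
    ∃ R : ℝ≥0, ∀ q ∈ admissiblePairs X Y σ ℓ L,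
      eLpNorm (fun x => colEquiv d m (q.2 x)) 2 σ.fst ≤ V →
      MemLp (mapGradVec d m q) 2 σ.fst ∧ eLpNorm (mapGradVec d m q) 2 σ.fst ≤ R := by
  obtain ⟨R, hR0, hR⟩ := h.exists_norm_le
  refine ⟨R.toNNReal + V.toNNReal, fun q hq hqV => ?_⟩
  have mG := h.aestronglyMeasurable_colEquiv hq.2.2.1
  have hm : AEStronglyMeasurable (mapGradVec d m q) σ.fst :=
    (WithLp.prod_continuous_toLp 2 _ _).comp_aestronglyMeasurable (hq.2.1.prodMk mG)
  have hle : eLpNorm (mapGradVec d m q) 2 σ.fst ≤ ENNReal.ofReal R + V := by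
    have hpt : ∀ x, ‖mapGradVec d m q x‖ ≤ ‖(fun x => ‖q.1 x‖) x + ‖colEquiv d m (q.2 x)‖‖ := by
      intro x
      rw [Real.norm_of_nonneg (by positivity)]
      refine le_of_sq_le_sq ?_ (by positivity)
      rw [WithLp.prod_norm_sq_eq_of_L2]
      simp only [mapGradVec, LinearMap.coe_mk, AddHom.coe_mk, WithLp.toLp_fst, WithLp.toLp_snd]
      nlinarith [norm_nonneg (q.1 x), norm_nonneg (colEquiv d m (q.2 x))]
    refine (eLpNorm_mono hpt).trans ?_
    refine (eLpNorm_add_le hq.2.1.norm mG.norm (by norm_num)).trans ?_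
    gcongr
    · refine (eLpNorm_le_of_ae_bound (C := R) ?_).trans ?_
      · filter_upwards [h.ae_fst_mem] with x hx
        simpa using hR _ hq.1 x hx
      · simp
    · rwa [eLpNorm_norm]
  have hfin : ENNReal.ofReal R + V = ((R.toNNReal + V.toNNReal : ℝ≥0) : ℝ≥0∞) := by
    rw [ENNReal.coe_add, ENNReal.coe_toNNReal hV]; rfl
  rw [hfin] at hle
  exact ⟨⟨hm, hle.trans_lt ENNReal.coe_lt_top⟩, hle⟩

/-- Compactness: a sequence of admissible pairs with gradients bounded by `V n` in `L^{P n}` from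
the index `n` on has a "limit" admissible pair satisfying all of these bounds. Its map is the
almost everywhere limit of the maps, if they converge. -/
theorem exists_admissible_limit [IsProbabilityMeasure σ] (h : IsRegularProblem X Y σ ℓ) {L : ℝ}
    (q : ℕ → (EucSp d → EucSp m) × (EucSp d → EucSp d →L[ℝ] EucSp m))
    (hq : ∀ n, q n ∈ admissiblePairs X Y σ ℓ L) (P V : ℕ → ℝ≥0∞) (hP : ∀ n, 2 ≤ P n)
    (hV0 : V 0 ≠ ∞)
    (hV : ∀ n k, n ≤ k → eLpNorm (fun x => colEquiv d m ((q k).2 x)) (P n) σ.fst ≤ V n) :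
    ∃ f G, (f, G) ∈ admissiblePairs X Y σ ℓ L ∧
      (∀ n, eLpNorm (fun x => colEquiv d m (G x)) (P n) σ.fst ≤ V n) ∧
      ∀ f' : EucSp d → EucSp m,
        (∀ᵐ x ∂σ.fst, Tendsto (fun n => (q n).1 x) atTop (𝓝 (f' x))) → f =ᵐ[σ.fst] f' := by
  obtain ⟨R, hR⟩ := h.memLp_mapGradVec (L := L) hV0
  have hq2 : ∀ n, eLpNorm (fun x => colEquiv d m ((q n).2 x)) 2 σ.fst ≤ V 0 := fun n =>
    (eLpNorm_le_eLpNorm_of_exponent_le (hP 0)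
      (h.aestronglyMeasurable_colEquiv (hq n).2.2.1)).trans (hV 0 n (Nat.zero_le n))
  obtain ⟨w, g, hw, hg, hae, hL2⟩ := exists_tendsto_ae_convexHull_tail (mapGradVec d m) q
    (fun n => (hR _ (hq n) (hq2 n)).1) R (fun n => (hR _ (hq n) (hq2 n)).2)
  have hwtail : ∀ n k, n ≤ k → w k ∈ admissiblePairs X Y σ ℓ L ∧
      eLpNorm (fun x => colEquiv d m ((w k).2 x)) (P n) σ.fst ≤ V n := by
    intro n k hnk
    refine convexHull_min ?_ (h.convex_admissiblePairs_sublevel L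
      (le_trans (by norm_num) (hP n)) (V n)) (hw k)
    rintro _ ⟨j, hj, rfl⟩
    exact ⟨hq j, hV n j (hnk.trans hj)⟩
  have hwadm : ∀ n, w n ∈ admissiblePairs X Y σ ℓ L := fun n => (hwtail n n le_rfl).1
  have hfst : ∀ᵐ x ∂σ.fst, Tendsto (fun n => (w n).1 x) atTop (𝓝 (g x).fst) := by
    filter_upwards [hae] with x hx
    exact ((WithLp.prod_continuous_ofLp 2 _ _).fst.tendsto (g x)).comp hx
  have hsnd : ∀ᵐ x ∂σ.fst, Tendsto (fun n => colEquiv d m ((w n).2 x)) atTop (𝓝 (g x).snd) := by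
    filter_upwards [hae] with x hx
    exact ((WithLp.prod_continuous_ofLp 2 _ _).snd.tendsto (g x)).comp hx
  classical
  obtain ⟨y₀, hy₀⟩ : ∃ y₀, y₀ ∈ Y := by
    obtain ⟨z, hz⟩ := h.ae_mem.exists
    exact ⟨z.2, hz.2⟩
  -- The limit lies in `Y` only almost everywhere, while admissibility asks for values in `Y` at
  -- every point of `X`; `y₀` fills the exceptional set.
  set f : EucSp d → EucSp m := fun x => if (g x).fst ∈ Y then (g x).fst else y₀ with hf
  set G : EucSp d → EucSp d →L[ℝ] EucSp m := fun x => (colEquiv d m).symm (g x).snd with hG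
  have hfY : MapsTo f X Y := by
    intro x _
    by_cases hx : (g x).fst ∈ Y
    · simp [hf, hx]
    · simpa [hf, hx] using hy₀
  have hflim : ∀ᵐ x ∂σ.fst, Tendsto (fun n => (w n).1 x) atTop (𝓝 (f x)) := by
    filter_upwards [hfst, h.ae_fst_mem] with x hx hxX
    have : (g x).fst ∈ Y := h.compact_right.isClosed.mem_of_tendsto hx
      (Eventually.of_forall fun n => (hwadm n).1 hxX)
    simpa [hf, this] using hx
  have hcolG : ∀ x, colEquiv d m (G x) = (g x).snd := fun x => by simp [hG]
  set S : PiLp 2 (fun _ : Fin d => EucSp m) →L[ℝ] (EucSp d →L[ℝ] EucSp m) :=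
    ((colEquiv d m).symm : PiLp 2 (fun _ : Fin d => EucSp m) →L[ℝ] (EucSp d →L[ℝ] EucSp m)) with hS
  have hsymm : ∀ a : WithLp 2 (EucSp m × PiLp 2 (fun _ : Fin d => EucSp m)),
      ‖S a.snd‖ ≤ ‖S‖ * ‖a‖ := by
    intro a
    refine (S.le_opNorm a.snd).trans ?_
    gcongr
    exact WithLp.norm_snd_le _ a
  have hmem := h.mem_admissiblePairs_of_tendsto hwadm (G := G) hfY hflim ?_ ?_
  · refine ⟨f, G, hmem, fun n => ?_, fun f' hf' => ?_⟩
    -- Fatou: the bound `V n` holds for the combinations of index at least `n`, which is enough for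
    -- the lower limit.
    · refine (Lp.eLpNorm_lim_le_liminf_eLpNorm
        (fun k => h.aestronglyMeasurable_colEquiv (hwadm k).2.2.1) _
        (hsnd.mono fun x hx => by rwa [hcolG x])).trans ?_
      refine (liminf_le_liminf (v := fun _ => V n)
        (eventually_atTop.2 ⟨n, fun k hk => (hwtail n k hk).2⟩)).trans ?_
      simp
    · filter_upwards [hf', hflim] with x hx hwx
      refine tendsto_nhds_unique hwx (Metric.tendsto_atTop.2 fun ε hε => ?_)
      obtain ⟨N, hN⟩ := Metric.tendsto_atTop.1 hx ε hε
      refine ⟨N, fun n hn => ?_⟩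
      -- Where the original maps converge, the tail values at `x` lie in a small ball; balls are
      -- convex, so the combinations have the same limit.
      have hconv : Convex ℝ {v : (EucSp d → EucSp m) × (EucSp d → EucSp d →L[ℝ] EucSp m) |
          v.1 x ∈ Metric.ball (f' x) ε} := by
        intro a ha b hb s t hs ht hst
        exact convex_ball (f' x) ε ha hb hs ht hst
      refine convexHull_min ?_ hconv (hw n)
      rintro _ ⟨j, hj, rfl⟩
      exact hN j (hn.trans hj)
  · have hG2 : MemLp G 2 σ.fst := hg.of_le_mul (c := ‖S‖)
      ((S.continuous.comp (WithLp.prod_continuous_ofLp 2 _ _).snd).comp_aestronglyMeasurable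
        hg.aestronglyMeasurable) (Eventually.of_forall fun x => hsymm (g x))
    exact hG2.integrable (by norm_num)
  · have h0 : Tendsto (fun n => ENNReal.ofReal ‖S‖ * eLpNorm (mapGradVec d m (w n) - g) 2 σ.fst)
        atTop (𝓝 0) := by
      have := ENNReal.Tendsto.const_mul hL2 (a := ENNReal.ofReal ‖S‖) (Or.inr (by simp))
      simpa using this
    refine tendsto_of_tendsto_of_tendsto_of_le_of_le tendsto_const_nhds h0 (fun _ => zero_le)
      fun n => ?_
    have hGm : AEStronglyMeasurable G σ.fst :=
      (S.continuous.comp (WithLp.prod_continuous_ofLp 2 _ _).snd).comp_aestronglyMeasurable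
        hg.aestronglyMeasurable
    refine (eLpNorm_le_eLpNorm_of_exponent_le (q := 2) (by norm_num)
      ((h.aestronglyMeasurable_grad (hwadm n).2.2.1).sub hGm)).trans ?_
    refine eLpNorm_le_mul_eLpNorm_of_ae_le_mul (Eventually.of_forall fun x => ?_) 2
    have e : ((w n).2 - G) x = S (mapGradVec d m (w n) x - g x).snd := by
      simp [hG, hS, mapGradVec]
    rw [e]
    exact hsymm _

end IsRegularProblem

/-! ### Lipschitz maps as Sobolev maps -/

/-- A Lipschitz map has its almost everywhere derivative as a weak gradient. -/
theorem LipschitzWith.hasWeakGrad_fderiv {C : ℝ≥0} {F : EucSp d → EucSp m} (hF : LipschitzWith C F)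
    (Ω : Set (EucSp d)) : HasWeakGrad Ω F (fderiv ℝ F) := by
  have hloc : LocallyIntegrable (fderiv ℝ F) volume := by
    refine (locallyIntegrable_const (C : ℝ)).mono
      (measurable_fderiv ℝ F).aestronglyMeasurable (Eventually.of_forall fun x => ?_)
    simpa using norm_fderiv_le_of_lipschitz ℝ hF
  refine ⟨hF.continuous.locallyIntegrable.locallyIntegrableOn Ω, hloc.locallyIntegrableOn Ω,
    fun φ hφ hcs hsub v => ?_⟩
  have hsub' := (tsupport_fderiv_apply_const_subset φ v).trans hsub
  have s1 : ∫ x in Ω, (fderiv ℝ φ x v) • F x = ∫ x, (fderiv ℝ φ x v) • F x :=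
    setIntegral_eq_integral_of_forall_compl_eq_zero fun x hx => by
      rw [image_eq_zero_of_notMem_tsupport (f := fun x => fderiv ℝ φ x v)
        (fun h => hx (hsub' h)), zero_smul]
  have s2 : ∫ x in Ω, φ x • fderiv ℝ F x v = ∫ x, φ x • fderiv ℝ F x v :=
    setIntegral_eq_integral_of_forall_compl_eq_zero fun x hx => by
      rw [image_eq_zero_of_notMem_tsupport (fun h => hx (hsub h)), zero_smul]
  rw [s1, s2]
  have i1 : Integrable fun x => (fderiv ℝ φ x v) • F x := by
    simpa using integrable_smul_of_tsupport_subset (Ω := univ) (μ := volume)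
      (hF.continuous.locallyIntegrable.locallyIntegrableOn univ)
      (hφ.continuous_fderiv_apply_const v) (hcs.fderiv_apply_const v) (subset_univ _)
  have i2 : Integrable fun x => φ x • fderiv ℝ F x v := by
    have := (integrable_smul_of_tsupport_subset (Ω := univ) (μ := volume)
      (hloc.locallyIntegrableOn univ)
      hφ.continuous hcs (subset_univ _)).apply_continuousLinearMap v
    simpa using this
  obtain ⟨D, hD⟩ := hφ.lipschitzWith_of_hasCompactSupport hcs (by simp)
  -- Coordinatewise the claim is integration by parts of line derivatives for two scalar Lipschitz
  -- functions, one compactly supported; Rademacher's theorem then identifies the line derivatives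
  -- with `fderiv`.
  ext j
  have hFj : LipschitzWith C fun x => F x j := by
    refine LipschitzWith.of_dist_le_mul fun x y => ?_
    refine le_trans ?_ (hF.dist_le_mul x y)
    rw [dist_eq_norm, dist_eq_norm]
    exact PiLp.norm_apply_le (F x - F y) j
  have key := hFj.integral_lineDeriv_mul_eq (μ := volume) hD hcs v
  have e1 : (∫ x, (fderiv ℝ φ x v) • F x) j = ∫ x, fderiv ℝ φ x v * F x j :=
    ((EuclideanSpace.proj j : EucSp m →L[ℝ] ℝ).integral_comp_comm i1).symm
  have e2 : (∫ x, φ x • fderiv ℝ F x v) j = ∫ x, φ x * fderiv ℝ F x v j :=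
    ((EuclideanSpace.proj j : EucSp m →L[ℝ] ℝ).integral_comp_comm i2).symm
  have e3 : ∫ x, lineDeriv ℝ (fun x => F x j) x v * φ x = ∫ x, φ x * fderiv ℝ F x v j := by
    refine integral_congr_ae ?_
    filter_upwards [hF.ae_differentiableAt (μ := volume)] with x hx
    have hd : HasFDerivAt (fun x => F x j)
        ((EuclideanSpace.proj j : EucSp m →L[ℝ] ℝ).comp (fderiv ℝ F x)) x :=
      (EuclideanSpace.proj j : EucSp m →L[ℝ] ℝ).hasFDerivAt.comp x hx.hasFDerivAt
    rw [hd.differentiableAt.lineDeriv_eq_fderiv, hd.fderiv, mul_comm]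
    rfl
  have e4 : ∫ x, lineDeriv ℝ φ x (-v) * F x j = -∫ x, fderiv ℝ φ x v * F x j := by
    rw [← integral_neg]
    refine integral_congr_ae (Eventually.of_forall fun x => ?_)
    simp only
    rw [((hφ.differentiable (by simp)) x).lineDeriv_eq_fderiv, map_neg, neg_mul]
  rw [e3, e4] at key
  rw [e1, PiLp.neg_apply, e2, key, neg_neg]

/-! ### Finiteness, monotonicity and attainment of the values -/

namespace IsRegularProblem

variable {X : Set (EucSp d)} {Y : Set (EucSp m)} {σ : Measure (EucSp d × EucSp m)}
  {ℓ : EucSp m → EucSp m → ℝ}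

/-- By uniqueness of weak gradients the choice inside `weakGrad` is immaterial, so any gradient at
hand may compute the seminorm. -/
theorem gradNorm_ae_eq (h : IsRegularProblem X Y σ ℓ) {f : EucSp d → EucSp m}
    {G : EucSp d → EucSp d →L[ℝ] EucSp m} (hG : HasWeakGrad (interior X) f G) :
    gradNorm X f =ᵐ[σ.fst] fun x => ‖colEquiv d m (G x)‖ := by
  filter_upwards [h.fst_ac.ae_le (hG.weakGrad_ae_eq isOpen_interior)] with x hx
  rw [gradNorm, hx, hsNorm_eq_norm_colEquiv]

theorem sobolevSeminorm_eq (h : IsRegularProblem X Y σ ℓ) {f : EucSp d → EucSp m}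
    {G : EucSp d → EucSp d →L[ℝ] EucSp m} (hG : HasWeakGrad (interior X) f G) (p : ℝ≥0∞) :
    sobolevSeminorm X σ.fst p f = eLpNorm (fun x => colEquiv d m (G x)) p σ.fst := by
  rw [sobolevSeminorm, eLpNorm_congr_ae (h.gradNorm_ae_eq hG), eLpNorm_norm]

theorem mem_feasibleSet [IsProbabilityMeasure σ] (h : IsRegularProblem X Y σ ℓ)
    {f : EucSp d → EucSp m} {G : EucSp d → EucSp d →L[ℝ] EucSp m} {α : ℝ≥0} {ε : ℝ}
    (hf : (f, G) ∈ admissiblePairs X Y σ ℓ (optimalLoss X Y σ ℓ α + ε)) {p : ℝ≥0∞}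
    (hp : eLpNorm (fun x => colEquiv d m (G x)) p σ.fst < ∞) :
    f ∈ feasibleSet X Y σ ℓ α ε p := by
  obtain ⟨hf1, hf2, hf3, hf4⟩ := hf
  obtain ⟨R, -, hR⟩ := h.exists_norm_le
  refine ⟨⟨hf1, MemLp.of_bound hf2 R ?_, ⟨G, hf3⟩, ?_⟩, hf4⟩
  · filter_upwards [h.ae_fst_mem] with x hx
    exact hR _ hf1 x hx
  · refine MemLp.ae_eq (h.gradNorm_ae_eq hf3).symm ?_
    exact MemLp.norm ⟨h.aestronglyMeasurable_colEquiv hf3, hp⟩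

theorem exists_of_mem_feasibleSet (h : IsRegularProblem X Y σ ℓ)
    {f : EucSp d → EucSp m} {α : ℝ≥0} {ε : ℝ} {p : ℝ≥0∞} (hf : f ∈ feasibleSet X Y σ ℓ α ε p) :
    ∃ G, (f, G) ∈ admissiblePairs X Y σ ℓ (optimalLoss X Y σ ℓ α + ε) ∧
      ∀ r, sobolevSeminorm X σ.fst r f = eLpNorm (fun x => colEquiv d m (G x)) r σ.fst := by
  obtain ⟨⟨hf1, hf2, ⟨G, hG⟩, -⟩, hf4⟩ := hf
  exact ⟨G, ⟨hf1, hf2.aestronglyMeasurable, hG, hf4⟩, fun r => h.sobolevSeminorm_eq hG r⟩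

/-- As `ε > 0`, some `α`-Lipschitz map has loss below the threshold. Extending it to the whole space
may enlarge the Lipschitz constant, which is harmless: only a finite bound, uniform in `p`, is
wanted. -/
theorem exists_admissible_bounded [IsProbabilityMeasure σ] (h : IsRegularProblem X Y σ ℓ)
    (α : ℝ≥0) {ε : ℝ} (hε : 0 < ε) :
    ∃ f G, (f, G) ∈ admissiblePairs X Y σ ℓ (optimalLoss X Y σ ℓ α + ε) ∧
      ∃ K : ℝ≥0, ∀ p : ℝ≥0∞, eLpNorm (fun x => colEquiv d m (G x)) p σ.fst ≤ K := by
  obtain ⟨z, hz⟩ := h.ae_mem.exists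
  have hne : (expectedLoss σ ℓ '' {f | MapsTo f X Y ∧ LipschitzOnWith α f X}).Nonempty :=
    ⟨_, fun _ => z.2, ⟨fun _ _ => hz.2, (LipschitzWith.const z.2).lipschitzOnWith.weaken
      zero_le⟩, rfl⟩
  obtain ⟨_, ⟨f, ⟨hfY, hfL⟩, rfl⟩, hfε⟩ := Real.lt_sInf_add_pos hne hε
  obtain ⟨F, hF, hfF⟩ := hfL.extend_finite_dimension
  have hFY : MapsTo F X Y := hfY.congr hfF
  have hloss : expectedLoss σ ℓ F = expectedLoss σ ℓ f := by
    refine integral_congr_ae ?_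
    filter_upwards [h.ae_mem] with z hz
    rw [hfF hz.1]
  let T : (EucSp d →L[ℝ] EucSp m) →L[ℝ] PiLp 2 (fun _ : Fin d => EucSp m) := colEquiv d m
  set K : ℝ≥0 := ‖T‖₊ * (lipschitzExtensionConstant (EucSp m) * α)
  refine ⟨F, fderiv ℝ F, ⟨hFY, hF.continuous.aestronglyMeasurable, hF.hasWeakGrad_fderiv _,
    hloss.trans_le hfε.le⟩, K, fun p => ?_⟩
  refine (eLpNorm_le_of_ae_bound (C := K) (Eventually.of_forall fun x => ?_)).trans ?_
  · refine (T.le_opNorm _).trans ?_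
    simp only [K, NNReal.coe_mul, coe_nnnorm]
    gcongr
    exact norm_fderiv_le_of_lipschitz ℝ hF
  · simp

theorem sobolevSeminorm_mono [IsProbabilityMeasure σ] (h : IsRegularProblem X Y σ ℓ) {p q r : ℝ≥0∞}
    (hpq : p ≤ q) {f : EucSp d → EucSp m} {α : ℝ≥0} {ε : ℝ} (hf : f ∈ feasibleSet X Y σ ℓ α ε r) :
    sobolevSeminorm X σ.fst p f ≤ sobolevSeminorm X σ.fst q f := by
  obtain ⟨G, hG, hs⟩ := h.exists_of_mem_feasibleSet hf
  rw [hs, hs]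
  exact eLpNorm_le_eLpNorm_of_exponent_le hpq (h.aestronglyMeasurable_colEquiv hG.2.2.1)

theorem feasibleSet_anti [IsProbabilityMeasure σ] {p q : ℝ≥0∞} (hpq : p ≤ q)
    (α : ℝ≥0) (ε : ℝ) : feasibleSet X Y σ ℓ α ε q ⊆ feasibleSet X Y σ ℓ α ε p :=
  fun _ ⟨⟨h1, h2, h3, h4⟩, h5⟩ => ⟨⟨h1, h2.mono_exponent hpq, h3, h4.mono_exponent hpq⟩, h5⟩

theorem lossConstrainedValue_mono [IsProbabilityMeasure σ] (h : IsRegularProblem X Y σ ℓ)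
    {p q : ℝ≥0∞} (hpq : p ≤ q) (α : ℝ≥0) (ε : ℝ) :
    lossConstrainedValue X Y σ ℓ α ε p ≤ lossConstrainedValue X Y σ ℓ α ε q :=
  le_iInf₂ fun f hf => (iInf₂_le f (feasibleSet_anti hpq α ε hf)).trans
    (h.sobolevSeminorm_mono hpq hf)

theorem exists_lossConstrainedValue_le [IsProbabilityMeasure σ] (h : IsRegularProblem X Y σ ℓ)
    (α : ℝ≥0) {ε : ℝ} (hε : 0 < ε) :
    ∃ K : ℝ≥0, ∀ p, lossConstrainedValue X Y σ ℓ α ε p ≤ K := by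
  obtain ⟨f, G, hf, K, hK⟩ := h.exists_admissible_bounded α hε
  refine ⟨K, fun p => ?_⟩
  refine (iInf₂_le f (h.mem_feasibleSet hf ((hK p).trans_lt ENNReal.coe_lt_top))).trans ?_
  rw [h.sobolevSeminorm_eq hf.2.2.1]
  exact hK p

theorem _root_.isLossConstrainedMin_iff {α : ℝ≥0} {ε : ℝ} {p : ℝ≥0∞} {f : EucSp d → EucSp m} :
    IsLossConstrainedMin X Y σ ℓ α ε p f ↔ f ∈ feasibleSet X Y σ ℓ α ε p ∧
      sobolevSeminorm X σ.fst p f ≤ lossConstrainedValue X Y σ ℓ α ε p := by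
  refine and_congr_right fun _ => ?_
  rw [lossConstrainedValue, le_iInf₂_iff, isMinOn_iff]

theorem isLossConstrainedMin_of_le [IsProbabilityMeasure σ] (h : IsRegularProblem X Y σ ℓ)
    {α : ℝ≥0} {ε : ℝ} (hε : 0 < ε) {p : ℝ≥0∞} {f : EucSp d → EucSp m}
    {G : EucSp d → EucSp d →L[ℝ] EucSp m}
    (hf : (f, G) ∈ admissiblePairs X Y σ ℓ (optimalLoss X Y σ ℓ α + ε))
    (hp : eLpNorm (fun x => colEquiv d m (G x)) p σ.fst ≤ lossConstrainedValue X Y σ ℓ α ε p) :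
    IsLossConstrainedMin X Y σ ℓ α ε p f := by
  obtain ⟨K, hK⟩ := h.exists_lossConstrainedValue_le (α := α) hε
  refine isLossConstrainedMin_iff.2 ⟨h.mem_feasibleSet hf
    (hp.trans_lt ((hK p).trans_lt ENNReal.coe_lt_top)), ?_⟩
  rwa [h.sobolevSeminorm_eq hf.2.2.1]

/-- The minimum is attained for every exponent `p ≥ 2`. -/
theorem exists_isLossConstrainedMin [IsProbabilityMeasure σ] (h : IsRegularProblem X Y σ ℓ)
    (α : ℝ≥0) {ε : ℝ} (hε : 0 < ε) {p : ℝ≥0∞} (hp : 2 ≤ p) :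
    ∃ f, IsLossConstrainedMin X Y σ ℓ α ε p f := by
  obtain ⟨K, hK⟩ := h.exists_lossConstrainedValue_le (α := α) hε
  set v := lossConstrainedValue X Y σ ℓ α ε p with hv
  have hvfin : v ≠ ∞ := ((hK p).trans_lt ENNReal.coe_lt_top).ne
  have hex : ∀ n : ℕ, ∃ q ∈ admissiblePairs X Y σ ℓ (optimalLoss X Y σ ℓ α + ε),
      eLpNorm (fun x => colEquiv d m (q.2 x)) p σ.fst ≤ v + ((n : ℝ≥0∞) + 1)⁻¹ := by
    intro n
    have hlt : v < v + ((n : ℝ≥0∞) + 1)⁻¹ := ENNReal.lt_add_right hvfin (by simp)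
    conv_lhs at hlt => rw [hv, lossConstrainedValue]
    simp only [iInf_lt_iff] at hlt
    obtain ⟨f, hf, hlt⟩ := hlt
    obtain ⟨G, hG, hs⟩ := h.exists_of_mem_feasibleSet hf
    exact ⟨(f, G), hG, by rw [← hs]; exact hlt.le⟩
  choose q hq hqv using hex
  -- The limit of this minimizing sequence obeys every bound `v + 1/(n+1)`, hence the bound `v`. The
  -- shift by one keeps the bound at `n = 0` finite.
  obtain ⟨f, G, hfG, hle, -⟩ := h.exists_admissible_limit q hq (fun _ => p)
    (fun n => v + ((n : ℝ≥0∞) + 1)⁻¹) (fun _ => hp) (by simp [hvfin]) (fun n k hnk => by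
      refine (hqv k).trans ?_
      gcongr)
  refine ⟨f, h.isLossConstrainedMin_of_le hε hfG ?_⟩
  have hlim : Tendsto (fun n : ℕ => v + ((n : ℝ≥0∞) + 1)⁻¹) atTop (𝓝 (v + 0)) := by
    refine tendsto_const_nhds.add ?_
    have := ENNReal.tendsto_inv_nat_nhds_zero.comp (tendsto_add_atTop_nat 1)
    refine this.congr fun n => ?_
    simp
  rw [add_zero] at hlim
  exact ge_of_tendsto' hlim hle

end IsRegularProblem

/-! ### Exponents tending to infinity -/

/-- Chebyshev: for `a > V` the set where the norm reaches `a` has measure at most `(V/a)^(n+2)` for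
every `n`, so it is null. -/
theorem eLpNorm_top_le_of_forall_nat {α E : Type*} [MeasurableSpace α] [NormedAddCommGroup E]
    {μ : Measure α} {g : α → E} (hg : AEStronglyMeasurable g μ) {V : ℝ≥0∞}
    (hV : ∀ n : ℕ, eLpNorm g ((n + 2 : ℕ) : ℝ≥0∞) μ ≤ V) : eLpNorm g ∞ μ ≤ V := by
  refine le_of_forall_gt_imp_ge_of_dense fun a ha => ?_
  rcases eq_or_ne a ∞ with rfl | hatop
  · exact le_top
  have ha0 : a ≠ 0 := (zero_le.trans_lt ha).ne'
  have hr : a⁻¹ * V < 1 := by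
    rw [mul_comm, ← div_eq_mul_inv, ENNReal.div_lt_iff (Or.inl ha0) (Or.inl hatop), one_mul]
    exact ha
  have hmeas : ∀ n : ℕ, μ {x | a ≤ ‖g x‖ₑ} ≤ (a⁻¹ * V) ^ (n + 2) := by
    intro n
    refine (meas_ge_le_mul_pow_eLpNorm_enorm μ (p := ((n + 2 : ℕ) : ℝ≥0∞)) (by simp) (by simp) hg
      ha0 (fun h => absurd h hatop)).trans ?_
    rw [ENNReal.toReal_natCast, ENNReal.rpow_natCast, ENNReal.rpow_natCast, mul_pow]
    gcongr
    exact hV n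
  have hzero : μ {x | a ≤ ‖g x‖ₑ} = 0 := by
    have ht := (ENNReal.tendsto_pow_atTop_nhds_zero_of_lt_one hr).comp (tendsto_add_atTop_nat 2)
    exact le_antisymm (ge_of_tendsto' ht hmeas) zero_le
  rw [eLpNorm_exponent_top]
  refine essSup_le_of_ae_le a ?_
  have : ∀ᵐ x ∂μ, ¬ a ≤ ‖g x‖ₑ := by
    rwa [ae_iff, show {x | ¬¬ a ≤ ‖g x‖ₑ} = {x | a ≤ ‖g x‖ₑ} by simp]
  filter_upwards [this] with x hx
  exact (not_le.1 hx).le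

namespace IsRegularProblem

variable {X : Set (EucSp d)} {Y : Set (EucSp m)} {σ : Measure (EucSp d × EucSp m)}
  {ℓ : EucSp m → EucSp m → ℝ}

/-- A subsequence of minimizers yields, in the limit, a minimizer for the exponent `∞`, with value
at most the supremum of the values. -/
theorem exists_limit_of_minimizers [IsProbabilityMeasure σ] (h : IsRegularProblem X Y σ ℓ)
    {α : ℝ≥0} {ε : ℝ} (hε : 0 < ε) {p : ℕ → ℕ} (hp : StrictMono p) (hp2 : ∀ n, 2 ≤ p n)
    {f : ℕ → EucSp d → EucSp m} (hf : ∀ n, IsLossConstrainedMin X Y σ ℓ α ε (p n) (f n)) :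
    ∃ g G, (g, G) ∈ admissiblePairs X Y σ ℓ (optimalLoss X Y σ ℓ α + ε) ∧
      eLpNorm (fun x => colEquiv d m (G x)) ∞ σ.fst ≤
        ⨆ n : ℕ, lossConstrainedValue X Y σ ℓ α ε n ∧
      ∀ f' : EucSp d → EucSp m,
        (∀ᵐ x ∂σ.fst, Tendsto (fun n => f n x) atTop (𝓝 (f' x))) → g =ᵐ[σ.fst] f' := by
  obtain ⟨K, hK⟩ := h.exists_lossConstrainedValue_le (α := α) hε
  choose G hG hs using fun n => h.exists_of_mem_feasibleSet (hf n).1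
  set V := ⨆ n : ℕ, lossConstrainedValue X Y σ ℓ α ε n with hVdef
  have hVfin : V ≠ ∞ := ((iSup_le fun n : ℕ => hK n).trans_lt ENNReal.coe_lt_top).ne
  have hpn : ∀ n, n + 2 ≤ p n := by
    intro n
    induction n with
    | zero => simpa using hp2 0
    | succ n ih => have := hp (Nat.lt_add_one n); omega
  -- For `k ≥ n` one has `p k ≥ n + 2`, so on a probability space the `L^{n+2}` seminorm of `f k` is
  -- at most its `L^{p k}` seminorm, which is at most `V`.
  obtain ⟨g, H, hgH, hle, hlim⟩ := h.exists_admissible_limit (fun n => (f n, G n)) hG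
    (fun n => ((n + 2 : ℕ) : ℝ≥0∞)) (fun _ => V)
    (fun n => by exact_mod_cast Nat.le_add_left 2 n) hVfin (fun n k hnk => by
      have hle : ((n + 2 : ℕ) : ℝ≥0∞) ≤ (p k : ℝ≥0∞) := by
        exact_mod_cast (Nat.add_le_add_right hnk 2).trans (hpn k)
      refine (eLpNorm_le_eLpNorm_of_exponent_le hle
        (h.aestronglyMeasurable_colEquiv (hG k).2.2.1)).trans ?_
      rw [← hs k]
      exact (isLossConstrainedMin_iff.1 (hf k)).2.trans
        (le_iSup (fun n : ℕ => lossConstrainedValue X Y σ ℓ α ε n) (p k)))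
  exact ⟨g, H, hgH, eLpNorm_top_le_of_forall_nat (h.aestronglyMeasurable_colEquiv hgH.2.2.1) hle,
    hlim⟩

/-- The values are monotone, so they tend to their supremum; the limit of minimizers is feasible for
`∞` and shows that the value there is no larger than this supremum. -/
theorem tendsto_lossConstrainedValue [IsProbabilityMeasure σ] (h : IsRegularProblem X Y σ ℓ)
    (α : ℝ≥0) {ε : ℝ} (hε : 0 < ε) :
    Tendsto (fun p : ℕ => lossConstrainedValue X Y σ ℓ α ε p) atTop
      (𝓝 (lossConstrainedValue X Y σ ℓ α ε ∞)) := by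
  choose f hf using fun n : ℕ => h.exists_isLossConstrainedMin α hε (p := ((n + 2 : ℕ) : ℝ≥0∞))
    (by exact_mod_cast Nat.le_add_left 2 n)
  obtain ⟨g, G, hgG, hle, -⟩ := h.exists_limit_of_minimizers hε (p := fun n => n + 2)
    (strictMono_id.add_const 2) (fun n => Nat.le_add_left 2 n) hf
  have hsup : ⨆ n : ℕ, lossConstrainedValue X Y σ ℓ α ε n =
      lossConstrainedValue X Y σ ℓ α ε ∞ := by
    refine le_antisymm (iSup_le fun n => h.lossConstrainedValue_mono le_top α ε) ?_
    obtain ⟨K, hK⟩ := h.exists_lossConstrainedValue_le (α := α) hε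
    have hfin : eLpNorm (fun x => colEquiv d m (G x)) ∞ σ.fst < ∞ :=
      hle.trans_lt ((iSup_le fun n : ℕ => hK n).trans_lt ENNReal.coe_lt_top)
    refine (iInf₂_le g (h.mem_feasibleSet hgG hfin)).trans ?_
    rwa [h.sobolevSeminorm_eq hgG.2.2.1]
  rw [← hsup]
  exact tendsto_atTop_iSup fun a b hab => h.lossConstrainedValue_mono (by exact_mod_cast hab) α ε

end IsRegularProblem

/-! ### Contracted averages and a Morrey estimate up to the boundary -/

/-- The average of `f` on `Ω` against the weight `η`, contracted towards `x` by the factor `s`. -/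
noncomputable def dilAvg (Ω : Set (EucSp d)) (η : EucSp d → ℝ) (f : EucSp d → EucSp m) (s : ℝ)
    (x : EucSp d) : EucSp m :=
  ∫ y in Ω, (s ^ d * η (x + s • (y - x))) • f y

/-- A smooth probability density with compact support in `Ω`. -/
structure IsSmoothWeight (Ω : Set (EucSp d)) (η : EucSp d → ℝ) : Prop where
  contDiff : ContDiff ℝ (⊤ : ℕ∞) η
  hasCompactSupport : HasCompactSupport η
  tsupport_subset : tsupport η ⊆ Ω
  integral_eq : ∫ y, η y = 1

theorem exists_isSmoothWeight {Ω : Set (EucSp d)} (hΩ : IsOpen Ω) (hne : Ω.Nonempty) :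
    ∃ η, IsSmoothWeight Ω η := by
  obtain ⟨x, hx⟩ := hne
  obtain ⟨r, hr, hball⟩ := Metric.isOpen_iff.1 hΩ x hx
  let b : ContDiffBump x := ⟨r / 4, r / 2, by positivity, by linarith⟩
  refine ⟨b.normed volume, b.contDiff_normed, b.hasCompactSupport_normed, ?_, b.integral_normed⟩
  rw [b.tsupport_normed_eq]
  exact (Metric.closedBall_subset_ball (by show r / 2 < r; linarith)).trans hball

namespace IsSmoothWeight

variable {X : Set (EucSp d)} {η : EucSp d → ℝ}

theorem exists_bound {Ω : Set (EucSp d)} (hη : IsSmoothWeight Ω η) :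
    ∃ M : ℝ, 0 ≤ M ∧ ∀ y, ‖η y‖ ≤ M := by
  obtain ⟨M, hM⟩ := hη.hasCompactSupport.exists_bound_of_continuous hη.contDiff.continuous
  exact ⟨M, (norm_nonneg _).trans (hM 0), hM⟩

theorem eq_zero_of_notMem {Ω : Set (EucSp d)} (hη : IsSmoothWeight Ω η) {z : EucSp d}
    (hz : z ∉ Ω) : η z = 0 :=
  image_eq_zero_of_notMem_tsupport fun h => hz (hη.tsupport_subset h)

theorem integrable_dil_smul {Ω : Set (EucSp d)} (hη : IsSmoothWeight Ω η) {f : EucSp d → EucSp m}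
    (hf : Integrable f (volume.restrict Ω)) (s : ℝ) (x : EucSp d) :
    Integrable (fun y => (s ^ d * η (x + s • (y - x))) • f y) (volume.restrict Ω) := by
  obtain ⟨M, hM0, hM⟩ := hη.exists_bound
  have := hη.contDiff.continuous
  have hc : Continuous fun y => s ^ d * η (x + s • (y - x)) := by fun_prop
  refine hf.bdd_smul (‖s ^ d‖ * M) hc.aestronglyMeasurable (Eventually.of_forall fun y => ?_)
  rw [norm_mul]
  gcongr
  exact hM _

/-- For fixed `s`, the contracted averages are Lipschitz, uniformly over bounded functions. -/
theorem exists_lipschitz_dilAvg {Ω : Set (EucSp d)} (hη : IsSmoothWeight Ω η)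
    (hfin : volume Ω ≠ ∞) (R s : ℝ) :
    ∃ L : ℝ, ∀ f : EucSp d → EucSp m, Integrable f (volume.restrict Ω) → (∀ y ∈ Ω, ‖f y‖ ≤ R) →
      ∀ x x', ‖dilAvg Ω η f s x - dilAvg Ω η f s x'‖ ≤ L * ‖x - x'‖ := by
  obtain ⟨C, hC⟩ := hη.contDiff.lipschitzWith_of_hasCompactSupport hη.hasCompactSupport (by simp)
  -- Moving the centre by `v` moves the argument of `η` by `(1 - s) • v`.
  refine ⟨|s| ^ d * (C * |1 - s|) * R * volume.real Ω, fun f hf hfR x x' => ?_⟩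
  rw [dilAvg, dilAvg, ← integral_sub (hη.integrable_dil_smul hf s x)
    (hη.integrable_dil_smul hf s x')]
  have hle := norm_setIntegral_le_of_norm_le_const (μ := volume) (s := Ω)
    (f := fun y => (s ^ d * η (x + s • (y - x))) • f y - (s ^ d * η (x' + s • (y - x'))) • f y)
    (C := |s| ^ d * (C * (|1 - s| * ‖x - x'‖)) * R) hfin.lt_top (fun y hy => by
      rw [← sub_smul, ← mul_sub, norm_smul, norm_mul, norm_pow, Real.norm_eq_abs s]
      have h1 := hC.norm_sub_le (x + s • (y - x)) (x' + s • (y - x'))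
      have h2 : x + s • (y - x) - (x' + s • (y - x')) = (1 - s) • (x - x') := by module
      rw [h2, norm_smul, Real.norm_eq_abs (1 - s)] at h1
      gcongr
      exact hfR y hy)
  refine hle.trans (le_of_eq ?_)
  ring

/-- `y` is the convex combination, with weight `s⁻¹`, of an interior point and `x ∈ X`. Thus even
for `x` on the boundary the contracted weight is supported in the interior. -/
theorem mem_of_dil_mem (hX : Convex ℝ X) {x y : EucSp d} (hx : x ∈ X) {s : ℝ} (hs : 1 ≤ s)
    (hy : x + s • (y - x) ∈ interior X) : y ∈ interior X := by
  have hs0 : 0 < s := by linarith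
  have key := hX.combo_interior_self_mem_interior hy hx (a := s⁻¹) (b := 1 - s⁻¹) (by positivity)
    (by rw [sub_nonneg]; exact inv_le_one_of_one_le₀ hs) (by ring)
  convert key using 1
  rw [smul_add, smul_smul, inv_mul_cancel₀ hs0.ne']
  module

theorem norm_sub_le_of_dil_mem {D : ℝ} (hD : ∀ a ∈ X, ∀ b ∈ X, ‖a - b‖ ≤ D) {x y : EucSp d}
    (hx : x ∈ X) {s : ℝ} (hs : 0 < s) (hy : x + s • (y - x) ∈ X) : ‖y - x‖ ≤ D * s⁻¹ := by
  have h := hD _ hy _ hx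
  rw [add_sub_cancel_left, norm_smul, Real.norm_of_nonneg hs.le] at h
  rwa [← div_eq_mul_inv, le_div_iff₀ hs, mul_comm]

theorem volume_dil_preimage (Ω : Set (EucSp d)) (x : EucSp d) {s : ℝ} (hs : 0 < s) :
    volume {y | x + s • (y - x) ∈ Ω} = ENNReal.ofReal ((s⁻¹) ^ d) * volume Ω := by
  have : {y | x + s • (y - x) ∈ Ω} = AffineMap.homothety x s⁻¹ '' Ω := by
    ext y
    simp only [mem_ofPred_eq, mem_image, AffineMap.homothety_apply, vsub_eq_sub, vadd_eq_add]
    constructor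
    · intro hy
      refine ⟨_, hy, ?_⟩
      rw [add_sub_cancel_left, smul_smul, inv_mul_cancel₀ hs.ne']
      module
    · rintro ⟨z, hz, rfl⟩
      rw [add_sub_cancel_right, smul_smul, mul_inv_cancel₀ hs.ne']
      simpa using hz
  rw [this, Measure.addHaar_image_homothety, finrank_euclideanSpace_fin,
    abs_of_nonneg (by positivity)]

/-- The integral of the contracted weight. -/
theorem integral_dil {Ω : Set (EucSp d)} (hη : IsSmoothWeight Ω η) (x : EucSp d) {s : ℝ}
    (hs : 0 < s) : ∫ y, s ^ d * η (x + s • (y - x)) = 1 := by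
  rw [integral_const_mul, integral_sub_right_eq_self (fun y => η (x + s • y)) x,
    Measure.integral_comp_smul volume (fun y => η (x + y)) s,
    integral_add_left_eq_self (fun y => η y) x, hη.integral_eq, finrank_euclideanSpace_fin,
    abs_of_nonneg (by positivity), smul_eq_mul, mul_one, mul_inv_cancel₀ (by positivity)]

end IsSmoothWeight

theorem single_eq_smul_single_one (i : Fin d) (a : ℝ) :
    EuclideanSpace.single i a = a • (EuclideanSpace.single i (1 : ℝ) : EucSp d) := by
  ext j
  by_cases h : j = i <;> simp [h]

namespace IsSmoothWeight

variable {X : Set (EucSp d)} {η : EucSp d → ℝ}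

theorem hasDerivAt_dil {Ω : Set (EucSp d)} (hη : IsSmoothWeight Ω η) (x y : EucSp d) (s : ℝ) :
    HasDerivAt (fun s : ℝ => s ^ d * η (x + s • (y - x)))
      (d * s ^ (d - 1) * η (x + s • (y - x)) +
        s ^ d * fderiv ℝ η (x + s • (y - x)) (y - x)) s := by
  have h1 : HasDerivAt (fun s : ℝ => x + s • (y - x)) (y - x) s := by
    simpa using ((hasDerivAt_id s).smul_const (y - x)).const_add x
  have h2 : HasDerivAt (fun s : ℝ => η (x + s • (y - x)))
      (fderiv ℝ η (x + s • (y - x)) (y - x)) s :=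
    ((hη.contDiff.differentiable (by simp)) _).hasFDerivAt.comp_hasDerivAt s h1
  exact (hasDerivAt_pow d s).mul h2

theorem hasDerivAt_dilAvg {Ω : Set (EucSp d)} (hη : IsSmoothWeight Ω η)
    (hΩb : Bornology.IsBounded Ω) (hΩ : MeasurableSet Ω)
    {f : EucSp d → EucSp m} (hf : Integrable f (volume.restrict Ω)) (x : EucSp d) (s : ℝ) :
    HasDerivAt (fun s => dilAvg Ω η f s x)
      (∫ y in Ω, (d * s ^ (d - 1) * η (x + s • (y - x)) +
        s ^ d * fderiv ℝ η (x + s • (y - x)) (y - x)) • f y) s := by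
  have hηc := hη.contDiff.continuous
  have hηd : Continuous (fderiv ℝ η) := hη.contDiff.continuous_fderiv (by simp)
  have hcont : Continuous fun p : ℝ × EucSp d => d * p.1 ^ (d - 1) * η (x + p.1 • (p.2 - x)) +
      p.1 ^ d * fderiv ℝ η (x + p.1 • (p.2 - x)) (p.2 - x) := by
    have h1 : Continuous fun p : ℝ × EucSp d => x + p.1 • (p.2 - x) := by fun_prop
    have h2 : Continuous fun p : ℝ × EucSp d => fderiv ℝ η (x + p.1 • (p.2 - x)) (p.2 - x) :=
      (hηd.comp h1).clm_apply (by fun_prop)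
    fun_prop
  -- The integrand's derivative in `s` is jointly continuous, so compactness supplies the dominating
  -- constant for differentiation under the integral.
  have hK : IsCompact (Metric.closedBall s 1 ×ˢ closure Ω) :=
    (isCompact_closedBall s 1).prod hΩb.isCompact_closure
  obtain ⟨B, hB⟩ := hK.exists_bound_of_continuousOn hcont.continuousOn
  have hm : ∀ s : ℝ, AEStronglyMeasurable (fun y => (s ^ d * η (x + s • (y - x))) • f y)
      (volume.restrict Ω) := fun s => (hη.integrable_dil_smul hf s x).aestronglyMeasurable
  refine (hasDerivAt_integral_of_dominated_loc_of_deriv_le (bound := fun y => B * ‖f y‖)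
    (F' := fun s y => (d * s ^ (d - 1) * η (x + s • (y - x)) +
        s ^ d * fderiv ℝ η (x + s • (y - x)) (y - x)) • f y)
    (Metric.closedBall_mem_nhds s one_pos) (Eventually.of_forall hm)
    (hη.integrable_dil_smul hf s x) ?_ ?_ (hf.norm.const_mul B) ?_).2
  · have : Continuous fun y : EucSp d => (d * s ^ (d - 1) * η (x + s • (y - x)) +
        s ^ d * fderiv ℝ η (x + s • (y - x)) (y - x)) := hcont.comp (Continuous.prodMk_right s)
    exact this.aestronglyMeasurable.smul hf.aestronglyMeasurable
  · filter_upwards [ae_restrict_mem hΩ] with y hy t ht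
    rw [norm_smul]
    gcongr
    exact hB (t, y) ⟨ht, subset_closure hy⟩
  · exact Eventually.of_forall fun y t _ => (hη.hasDerivAt_dil x y t).smul_const (f y)

/-- The derivative of the contracted averages in terms of the weak gradient. -/
theorem integral_deriv_dil_eq (hX : Convex ℝ X) (hη : IsSmoothWeight (interior X) η)
    {f : EucSp d → EucSp m} {G : EucSp d → EucSp d →L[ℝ] EucSp m}
    (hG : HasWeakGrad (interior X) f G) {x : EucSp d} (hx : x ∈ X) {s : ℝ} (hs : 1 ≤ s) :
    ∫ y in interior X, (d * s ^ (d - 1) * η (x + s • (y - x)) +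
        s ^ d * fderiv ℝ η (x + s • (y - x)) (y - x)) • f y =
      -∫ y in interior X, (s ^ d * s⁻¹ * η (x + s • (y - x))) • G y (y - x) := by
  have hs0 : 0 < s := by linarith
  have hηc := hη.contDiff
  have htranslate : ContDiff ℝ (⊤ : ℕ∞) fun y : EucSp d => x + s • (y - x) := by fun_prop
  -- Components of the vector field `s ^ (d-1) η(x + s(y-x)) (y-x)`. Its divergence in `y` is
  -- exactly the `s`-derivative of the contracted weight, so testing the weak gradient against each
  -- component and summing gives the identity.
  set φ : Fin d → EucSp d → ℝ := fun i y =>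
    (s ^ d * s⁻¹) * (η (x + s • (y - x)) * (y - x) i) with hφ
  have hcd : ∀ i, ContDiff ℝ (⊤ : ℕ∞) (φ i) := fun i => by
    have h1 : ContDiff ℝ (⊤ : ℕ∞) fun y : EucSp d => (y - x) i :=
      (EuclideanSpace.proj i : EucSp d →L[ℝ] ℝ).contDiff.comp (contDiff_id.sub contDiff_const)
    exact contDiff_const.mul ((hηc.comp htranslate).mul h1)
  have hsupp : ∀ i, tsupport (φ i) ⊆ {y | x + s • (y - x) ∈ tsupport η} := fun i => by
    refine closure_minimal (fun y hy => ?_)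
      ((isClosed_tsupport η).preimage htranslate.continuous)
    refine subset_tsupport η fun h0 => hy ?_
    simp [hφ, h0]
  have hsub : ∀ i, tsupport (φ i) ⊆ interior X := fun i y hy =>
    mem_of_dil_mem hX hx hs (hη.tsupport_subset (hsupp i hy))
  have hcs : ∀ i, HasCompactSupport (φ i) := fun i => by
    have hcomp : IsCompact {y | x + s • (y - x) ∈ tsupport η} := by
      have himg : {y | x + s • (y - x) ∈ tsupport η} =
          (fun z => x + s⁻¹ • (z - x)) '' tsupport η := by
        ext y
        constructor
        · intro hy
          refine ⟨_, hy, ?_⟩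
          simp only [add_sub_cancel_left]
          rw [smul_smul, inv_mul_cancel₀ hs0.ne', one_smul, add_sub_cancel]
        · rintro ⟨z, hz, rfl⟩
          show x + s • (x + s⁻¹ • (z - x) - x) ∈ tsupport η
          rw [add_sub_cancel_left, smul_smul, mul_inv_cancel₀ hs0.ne', one_smul, add_sub_cancel]
          exact hz
      rw [himg]
      exact IsCompact.image hη.hasCompactSupport (by fun_prop)
    exact hcomp.of_isClosed_subset (isClosed_tsupport _) (hsupp i)
  have hderiv : ∀ i y, fderiv ℝ (φ i) y (EuclideanSpace.single i 1) =
      (s ^ d * s⁻¹) * (η (x + s • (y - x)) +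
        s * fderiv ℝ η (x + s • (y - x)) (EuclideanSpace.single i ((y - x) i))) := by
    intro i y
    have h1 : HasFDerivAt (fun y : EucSp d => x + s • (y - x))
        (s • ContinuousLinearMap.id ℝ (EucSp d)) y :=
      (((hasFDerivAt_id y).sub_const x).const_smul s).const_add x
    have h2 := ((hηc.differentiable (by simp)) (x + s • (y - x))).hasFDerivAt.comp y h1
    have h3 : HasFDerivAt (fun y : EucSp d => (y - x) i)
        (EuclideanSpace.proj i : EucSp d →L[ℝ] ℝ) y :=
      (EuclideanSpace.proj i : EucSp d →L[ℝ] ℝ).hasFDerivAt.comp y ((hasFDerivAt_id y).sub_const x)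
    have h4 := (h2.mul h3).const_mul (s ^ d * s⁻¹)
    rw [show φ i = fun y => (s ^ d * s⁻¹) *
      (((η ∘ fun y => x + s • (y - x)) * fun y => (y - x) i) y) from rfl, h4.fderiv, single_eq_smul_single_one i ((y - x) i), map_smul]
    simp
    ring
  have hsum : ∀ y : EucSp d, ∑ i, EuclideanSpace.single i ((y - x) i) = y - x := fun y => by
    ext j
    simp
  have e1 : ∀ y, (d * s ^ (d - 1) * η (x + s • (y - x)) +
        s ^ d * fderiv ℝ η (x + s • (y - x)) (y - x)) • f y =
      ∑ i, (fderiv ℝ (φ i) y (EuclideanSpace.single i 1)) • f y := by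
    intro y
    rw [← Finset.sum_smul]
    congr 1
    simp_rw [hderiv]
    rw [← Finset.mul_sum, Finset.sum_add_distrib, ← Finset.mul_sum, ← map_sum, hsum]
    simp only [Finset.sum_const, Finset.card_univ, Fintype.card_fin, nsmul_eq_mul]
    have hpow : (d : ℝ) * s ^ (d - 1) = d * (s ^ d * s⁻¹) := by
      rcases Nat.eq_zero_or_pos d with h0 | h0
      · simp [h0]
      · rw [← pow_sub_one_mul h0.ne' s, mul_assoc (s ^ (d - 1)), mul_inv_cancel₀ hs0.ne', mul_one]
    rw [hpow, mul_add]
    field_simp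
  have e2 : ∀ y, (s ^ d * s⁻¹ * η (x + s • (y - x))) • G y (y - x) =
      ∑ i, φ i y • G y (EuclideanSpace.single i 1) := by
    intro y
    conv_lhs => rw [← hsum y, map_sum, Finset.smul_sum]
    refine Finset.sum_congr rfl fun i _ => ?_
    rw [hsum y, single_eq_smul_single_one i ((y - x) i), map_smul, smul_smul, hφ, mul_assoc]
  simp_rw [e1, e2]
  rw [integral_finsetSum _ fun i _ => hG.integrable_fderiv_smul (hcd i) (hcs i) (hsub i) _,
    integral_finsetSum _ fun i _ =>
      hG.integrable_smul_grad_apply (hcd i).continuous (hcs i) (hsub i) _, ← Finset.sum_neg_distrib]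
  exact Finset.sum_congr rfl fun i _ => hG.2.2 (φ i) (hcd i) (hcs i) (hsub i) _

end IsSmoothWeight

namespace IsSmoothWeight

variable {X : Set (EucSp d)} {η : EucSp d → ℝ}

/-- Hölder with exponent `d + 1`, the first integer above the dimension; the power of the volume it
leaves decides the rate of decay. -/
theorem setIntegral_norm_le (hX : IsCompact X) {G : EucSp d → EucSp d →L[ℝ] EucSp m}
    (hG : MemLp G ((d + 1 : ℕ) : ℝ≥0∞) (volume.restrict (interior X))) {S : Set (EucSp d)}
    (hS : S ⊆ interior X) :
    ∫ y in S, ‖G y‖ ≤ (eLpNorm G ((d + 1 : ℕ) : ℝ≥0∞) (volume.restrict (interior X))).toReal *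
      (volume S).toReal ^ ((d : ℝ) / (d + 1)) := by
  have hmeas : AEStronglyMeasurable G (volume.restrict S) :=
    hG.aestronglyMeasurable.mono_measure (Measure.restrict_mono hS le_rfl)
  have hSfin : volume S ≠ ∞ :=
    ((measure_mono (hS.trans interior_subset)).trans_lt hX.measure_lt_top).ne
  rw [integral_norm_eq_lintegral_enorm hmeas, ← eLpNorm_one_eq_lintegral_enorm]
  have h1 := eLpNorm_le_eLpNorm_mul_rpow_measure_univ (p := 1) (q := ((d + 1 : ℕ) : ℝ≥0∞))
    (by exact_mod_cast Nat.le_add_left 1 d) hmeas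
  have hexp : 1 / (1 : ℝ≥0∞).toReal - 1 / (((d + 1 : ℕ) : ℝ≥0∞)).toReal = (d : ℝ) / (d + 1) := by
    rw [ENNReal.toReal_natCast]
    push_cast
    simp only [ENNReal.toReal_one]
    field_simp
    ring
  rw [hexp, Measure.restrict_apply_univ] at h1
  have h2 : eLpNorm G 1 (volume.restrict S) ≤
      eLpNorm G ((d + 1 : ℕ) : ℝ≥0∞) (volume.restrict (interior X)) *
        volume S ^ ((d : ℝ) / (d + 1)) := by
    refine h1.trans ?_
    gcongr
  have h3 := ENNReal.toReal_mono (ENNReal.mul_ne_top hG.eLpNorm_ne_top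
    (ENNReal.rpow_ne_top_of_nonneg (by positivity) hSfin)) h2
  rwa [ENNReal.toReal_mul, ← ENNReal.toReal_rpow] at h3

theorem rpow_dil_exponent (n : ℕ) {t : ℝ} (ht : 0 < t) :
    (t ^ n) ^ ((n : ℝ) / (n + 1)) * t = t ^ n * t ^ ((1 : ℝ) / (n + 1)) := by
  rw [← Real.rpow_natCast, ← Real.rpow_mul ht.le, ← Real.rpow_add ht]
  nth_rewrite 2 [← Real.rpow_one t]
  rw [← Real.rpow_add ht]
  congr 1
  field_simp
  ring

/-- The decay of the derivative of the contracted averages. -/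
theorem exists_norm_integral_grad_le (hX : IsCompact X) (hXc : Convex ℝ X)
    (hη : IsSmoothWeight (interior X) η) :
    ∃ C : ℝ, 0 ≤ C ∧ ∀ G : EucSp d → EucSp d →L[ℝ] EucSp m,
      MemLp G ((d + 1 : ℕ) : ℝ≥0∞) (volume.restrict (interior X)) → ∀ x ∈ X, ∀ s : ℝ, 1 ≤ s →
        ‖∫ y in interior X, (s ^ d * s⁻¹ * η (x + s • (y - x))) • G y (y - x)‖ ≤
          C * (eLpNorm G ((d + 1 : ℕ) : ℝ≥0∞) (volume.restrict (interior X))).toReal *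
            (s⁻¹ * s⁻¹ ^ ((1 : ℝ) / (d + 1))) := by
  obtain ⟨M, hM0, hM⟩ := hη.exists_bound
  obtain ⟨D, hD0, hD⟩ : ∃ D : ℝ, 0 ≤ D ∧ ∀ a ∈ X, ∀ b ∈ X, ‖a - b‖ ≤ D :=
    ⟨Metric.diam X, Metric.diam_nonneg, fun a ha b hb => by
      rw [← dist_eq_norm]; exact Metric.dist_le_diam_of_mem hX.isBounded ha hb⟩
  set W := (volume (interior X)).toReal with hW
  refine ⟨M * D * W ^ ((d : ℝ) / (d + 1)), by positivity, fun G hG x hx s hs => ?_⟩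
  set N := (eLpNorm G ((d + 1 : ℕ) : ℝ≥0∞) (volume.restrict (interior X))).toReal with hN
  have hs0 : 0 < s := by linarith
  set S := {y | x + s • (y - x) ∈ interior X} with hS
  have hSsub : S ⊆ interior X := fun y hy => mem_of_dil_mem hXc hx hs hy
  have hSm : MeasurableSet S := by
    have : Continuous fun y : EucSp d => x + s • (y - x) := by fun_prop
    exact (isOpen_interior.preimage this).measurableSet
  have hfin : IsFiniteMeasure (volume.restrict (interior X)) :=
    ⟨by
      rw [Measure.restrict_apply_univ]
      exact (measure_mono interior_subset).trans_lt hX.measure_lt_top⟩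
  have hGi : Integrable G (volume.restrict (interior X)) :=
    hG.integrable (by exact_mod_cast Nat.le_add_left 1 d)
  -- The first factors bound the weight; `D * s⁻¹` bounds `‖y - x‖` on the contracted set `S`.
  -- Together with the volume of `S`, of order `s ^ (-d)`, this leaves `s ^ (-1 - 1/(d+1))`.
  set c := s ^ d * s⁻¹ * M * (D * s⁻¹) with hc
  have hpt : ∀ y, ‖(s ^ d * s⁻¹ * η (x + s • (y - x))) • G y (y - x)‖ ≤
      S.indicator (fun y => c * ‖G y‖) y := by
    intro y
    by_cases hy : y ∈ S
    · rw [indicator_of_mem hy, norm_smul, norm_mul, Real.norm_of_nonneg (by positivity)]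
      have h1 := hM (x + s • (y - x))
      have h2 := (G y).le_opNorm (y - x)
      have h3 := norm_sub_le_of_dil_mem hD hx hs0 (interior_subset hy)
      calc s ^ d * s⁻¹ * ‖η (x + s • (y - x))‖ * ‖G y (y - x)‖
          ≤ s ^ d * s⁻¹ * M * (‖G y‖ * (D * s⁻¹)) := by
            gcongr
            exact h2.trans (by gcongr)
        _ = c * ‖G y‖ := by rw [hc]; ring
    · rw [hη.eq_zero_of_notMem hy]
      simp [hy]
  have hle : ‖∫ y in interior X, (s ^ d * s⁻¹ * η (x + s • (y - x))) • G y (y - x)‖ ≤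
      c * ∫ y in S, ‖G y‖ := by
    refine (norm_integral_le_of_norm_le ((hGi.norm.const_mul c).indicator hSm)
      (Eventually.of_forall hpt)).trans (le_of_eq ?_)
    rw [integral_indicator hSm, Measure.restrict_restrict hSm, inter_eq_left.2 hSsub,
      integral_const_mul]
  have hvol : (volume S).toReal = (s⁻¹) ^ d * W := by
    rw [hS, volume_dil_preimage _ _ hs0, ENNReal.toReal_mul, ENNReal.toReal_ofReal (by positivity)]
  have hint := setIntegral_norm_le hX hG hSsub
  rw [hvol, Real.mul_rpow (by positivity) ENNReal.toReal_nonneg] at hint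
  refine (hle.trans (mul_le_mul_of_nonneg_left hint (by positivity))).trans (le_of_eq ?_)
  have key := rpow_dil_exponent d (inv_pos.2 hs0)
  have hsd : s ^ d * s⁻¹ ^ d = 1 := by rw [← mul_pow, mul_inv_cancel₀ hs0.ne', one_pow]
  calc c * (N * ((s⁻¹ ^ d) ^ ((d : ℝ) / (d + 1)) * W ^ ((d : ℝ) / (d + 1))))
      = M * D * W ^ ((d : ℝ) / (d + 1)) * N * (s⁻¹ * (s ^ d *
          ((s⁻¹ ^ d) ^ ((d : ℝ) / (d + 1)) * s⁻¹))) := by rw [hc]; ring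
    _ = M * D * W ^ ((d : ℝ) / (d + 1)) * N * (s⁻¹ * ((s ^ d * s⁻¹ ^ d) *
          s⁻¹ ^ ((1 : ℝ) / (d + 1)))) := by rw [key]; ring
    _ = _ := by rw [hsd, one_mul]

/-- Morrey-type estimate: the averages at dyadic scales converge geometrically. -/
theorem exists_norm_dilAvg_succ_sub_le (hX : IsCompact X) (hXc : Convex ℝ X)
    (hη : IsSmoothWeight (interior X) η) :
    ∃ C : ℝ, 0 ≤ C ∧ ∀ (f : EucSp d → EucSp m) (G : EucSp d → EucSp d →L[ℝ] EucSp m),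
      HasWeakGrad (interior X) f G → Integrable f (volume.restrict (interior X)) →
      MemLp G ((d + 1 : ℕ) : ℝ≥0∞) (volume.restrict (interior X)) → ∀ x ∈ X, ∀ k : ℕ,
        ‖dilAvg (interior X) η f (2 ^ (k + 1)) x - dilAvg (interior X) η f (2 ^ k) x‖ ≤
          C * (eLpNorm G ((d + 1 : ℕ) : ℝ≥0∞) (volume.restrict (interior X))).toReal *
            ((1 / 2 : ℝ) ^ ((1 : ℝ) / (d + 1))) ^ k := by
  obtain ⟨C, hC0, hC⟩ := exists_norm_integral_grad_le (m := m) hX hXc hη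
  refine ⟨C, hC0, fun f G hG hf hGp x hx k => ?_⟩
  set N := (eLpNorm G ((d + 1 : ℕ) : ℝ≥0∞) (volume.restrict (interior X))).toReal with hN
  have h2k : (1 : ℝ) ≤ 2 ^ k := one_le_pow₀ (by norm_num)
  set b : ℝ := (2 ^ k)⁻¹ with hb
  have hder : ∀ s ∈ Icc ((2 : ℝ) ^ k) (2 ^ (k + 1)),
      HasDerivWithinAt (fun s => dilAvg (interior X) η f s x)
        (∫ y in interior X, (d * s ^ (d - 1) * η (x + s • (y - x)) +
          s ^ d * fderiv ℝ η (x + s • (y - x)) (y - x)) • f y)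
        (Icc ((2 : ℝ) ^ k) (2 ^ (k + 1))) s :=
    fun s _ => (hη.hasDerivAt_dilAvg (hX.isBounded.subset interior_subset)
      isOpen_interior.measurableSet hf x s).hasDerivWithinAt
  have hbound : ∀ s ∈ Icc ((2 : ℝ) ^ k) (2 ^ (k + 1)),
      ‖∫ y in interior X, (d * s ^ (d - 1) * η (x + s • (y - x)) +
          s ^ d * fderiv ℝ η (x + s • (y - x)) (y - x)) • f y‖ ≤
        C * N * (b * b ^ ((1 : ℝ) / (d + 1))) := by
    intro s hs
    have hs1 : 1 ≤ s := h2k.trans hs.1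
    have hs0 : 0 < s := by linarith
    rw [integral_deriv_dil_eq hXc hη hG hx hs1, norm_neg]
    refine (hC G hGp x hx s hs1).trans ?_
    have hsb : s⁻¹ ≤ b := inv_anti₀ (by positivity) hs.1
    gcongr
  -- Mean value inequality between consecutive dyadic scales: the length `2 ^ k` cancels one factor
  -- `b`, and the remaining `b ^ (1/(d+1))` is the geometric decay.
  have hmv := Convex.norm_image_sub_le_of_norm_hasDerivWithin_le hder hbound (convex_Icc _ _)
    (x := 2 ^ k) (y := 2 ^ (k + 1)) ⟨le_rfl, by rw [pow_succ]; linarith⟩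
    ⟨by rw [pow_succ]; linarith, le_rfl⟩
  refine hmv.trans (le_of_eq ?_)
  have h1 : ‖(2 : ℝ) ^ (k + 1) - 2 ^ k‖ = 2 ^ k := by
    rw [pow_succ, Real.norm_of_nonneg (by linarith)]; ring
  have h2 : b ^ ((1 : ℝ) / (d + 1)) = ((1 / 2 : ℝ) ^ ((1 : ℝ) / (d + 1))) ^ k := by
    rw [← Real.rpow_natCast, ← Real.rpow_mul (by norm_num), mul_comm ((1 : ℝ) / (d + 1)),
      Real.rpow_mul (by norm_num), Real.rpow_natCast, hb, one_div_pow, one_div ((2 : ℝ) ^ k)]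
  rw [h1, h2]
  have h3 : b * 2 ^ k = 1 := inv_mul_cancel₀ (by positivity)
  linear_combination (C * N * ((1 / 2 : ℝ) ^ ((1 : ℝ) / (d + 1))) ^ k) * h3

/-- The averages at dyadic scales converge to the function at its Lebesgue points. -/
theorem ae_tendsto_dilAvg (hX : IsCompact X) (hη : IsSmoothWeight (interior X) η)
    {f : EucSp d → EucSp m} (hf : Integrable f (volume.restrict (interior X))) :
    ∀ᵐ x ∂volume.restrict (interior X),
      Tendsto (fun k : ℕ => dilAvg (interior X) η f (2 ^ k) x) atTop (𝓝 (f x)) := by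
  obtain ⟨M, hM0, hM⟩ := hη.exists_bound
  obtain ⟨D, hD0, hD⟩ : ∃ D : ℝ, 0 < D ∧ ∀ a ∈ X, ∀ b ∈ X, ‖a - b‖ ≤ D :=
    ⟨Metric.diam X + 1, by linarith [Metric.diam_nonneg (s := X)], fun a ha b hb => by
      rw [← dist_eq_norm]; linarith [Metric.dist_le_diam_of_mem hX.isBounded ha hb]⟩
  have hΩm : MeasurableSet (interior X) := isOpen_interior.measurableSet
  set g := (interior X).indicator f with hg
  have hgi : Integrable g := (integrable_indicator_iff hΩm).2 hf
  have hleb := IsUnifLocDoublingMeasure.ae_tendsto_average_norm_sub volume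
    hgi.locallyIntegrable 1
  filter_upwards [ae_restrict_of_ae hleb, ae_restrict_mem hΩm] with x hx hxΩ
  have hδ : Tendsto (fun k : ℕ => D * (1 / 2 : ℝ) ^ k) atTop (𝓝[>] 0) := by
    refine tendsto_nhdsWithin_iff.2 ⟨?_, Eventually.of_forall fun k => by
      show 0 < D * (1 / 2 : ℝ) ^ k; positivity⟩
    simpa using (tendsto_pow_atTop_nhds_zero_of_lt_one (r := (1 / 2 : ℝ)) (by norm_num)
      (by norm_num)).const_mul D
  have hav := hx (fun _ => x) (fun k : ℕ => D * (1 / 2 : ℝ) ^ k) hδ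
    (Eventually.of_forall fun k => Metric.mem_closedBall_self (by positivity))
  rw [tendsto_iff_norm_sub_tendsto_zero]
  -- The contracted weight is at most `s ^ d * M` and lives in a ball of radius `D * s⁻¹`; `c` is
  -- the product of this height with the volume of the ball, independent of `s`.
  set c := M * D ^ d * volume.real (Metric.closedBall (0 : EucSp d) 1) with hc
  have hlim0 := hav.const_mul c
  rw [mul_zero] at hlim0
  refine squeeze_zero (fun _ => norm_nonneg _) (fun k => ?_) hlim0
  set s : ℝ := 2 ^ k with hs
  have hs0 : 0 < s := by positivity
  have hsinv : (1 / 2 : ℝ) ^ k = s⁻¹ := by rw [hs, one_div, inv_pow]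
  rw [hsinv]
  set B := Metric.closedBall x (D * s⁻¹) with hB
  have hgx : f x = g x := (indicator_of_mem hxΩ f).symm
  have hA : dilAvg (interior X) η f s x = ∫ y, (s ^ d * η (x + s • (y - x))) • g y := by
    rw [dilAvg, ← integral_indicator hΩm]
    congr 1
    funext y
    by_cases hy : y ∈ interior X <;> simp [hg, hy]
  have hηi : Integrable fun y => s ^ d * η (x + s • (y - x)) := by
    by_contra h
    have := hη.integral_dil x hs0
    rw [integral_undef h] at this
    exact zero_ne_one this
  have hfx : f x = ∫ y, (s ^ d * η (x + s • (y - x))) • g x := by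
    rw [integral_smul_const, hη.integral_dil x hs0, one_smul, hgx]
  have hgint : Integrable fun y => (s ^ d * η (x + s • (y - x))) • g y := by
    have := (integrable_indicator_iff hΩm).2 (hη.integrable_dil_smul hf s x)
    refine this.congr (Eventually.of_forall fun y => ?_)
    by_cases hy : y ∈ interior X <;> simp [hg, hy]
  rw [hA, hfx, ← integral_sub hgint (hηi.smul_const (g x))]
  have hsubi : Integrable (fun y => ‖g y - g x‖) (volume.restrict B) :=
    (hgi.restrict.sub (integrable_const_iff.2 (Or.inr
      ⟨by simpa using (isCompact_closedBall x (D * s⁻¹)).measure_lt_top⟩))).norm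
  have hpt : ∀ y, ‖(s ^ d * η (x + s • (y - x))) • g y - (s ^ d * η (x + s • (y - x))) • g x‖ ≤
      B.indicator (fun y => (s ^ d * M) * ‖g y - g x‖) y := by
    intro y
    rw [← smul_sub, norm_smul, norm_mul, norm_pow, Real.norm_of_nonneg hs0.le]
    by_cases hy : x + s • (y - x) ∈ interior X
    · have hyB : y ∈ B := by
        rw [hB, mem_closedBall_iff_norm]
        exact norm_sub_le_of_dil_mem hD (interior_subset hxΩ) hs0 (interior_subset hy)
      rw [indicator_of_mem hyB]
      gcongr
      exact hM _
    · rw [hη.eq_zero_of_notMem hy]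
      simp only [norm_zero, mul_zero, zero_mul]
      exact indicator_nonneg (fun _ _ => by positivity) _
  have hBm : MeasurableSet B := Metric.isClosed_closedBall.measurableSet
  refine (norm_integral_le_of_norm_le ((integrable_indicator_iff hBm).2 (hsubi.const_mul _))
    (Eventually.of_forall hpt)).trans (le_of_eq ?_)
  rw [integral_indicator hBm, integral_const_mul, setAverage_eq, smul_eq_mul]
  have hvol : volume.real B = (D * s⁻¹) ^ d * volume.real (Metric.closedBall (0 : EucSp d) 1) := by
    rw [hB, Measure.real, Measure.addHaar_closedBall' volume x (by positivity),
      ENNReal.toReal_mul, ENNReal.toReal_ofReal (by positivity), finrank_euclideanSpace_fin]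
    rfl
  have hvol1 : 0 < volume.real (Metric.closedBall (0 : EucSp d) 1) :=
    ENNReal.toReal_pos (Metric.measure_closedBall_pos volume _ one_pos).ne'
      (isCompact_closedBall _ _).measure_lt_top.ne
  rw [hvol, hc]
  field_simp
  rw [div_pow]
  field_simp

end IsSmoothWeight

/-! ### Equicontinuous representatives -/

namespace IsRegularProblem

variable {X : Set (EucSp d)} {Y : Set (EucSp m)} {σ : Measure (EucSp d × EucSp m)}
  {ℓ : EucSp m → EucSp m → ℝ}

/-- Translates the seminorm bounds into those of the Morrey estimate: the density bound replaces the
marginal by Lebesgue measure, the inverse of `colEquiv` replaces the column norm by the operator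
norm. -/
theorem exists_eLpNorm_restrict_le (h : IsRegularProblem X Y σ ℓ) (q : ℕ) (V : ℝ≥0) :
    ∃ N : ℝ, 0 ≤ N ∧ ∀ (f : EucSp d → EucSp m) (G : EucSp d → EucSp d →L[ℝ] EucSp m),
      HasWeakGrad (interior X) f G → eLpNorm (fun x => colEquiv d m (G x)) q σ.fst ≤ V →
        MemLp G q (volume.restrict (interior X)) ∧
          (eLpNorm G q (volume.restrict (interior X))).toReal ≤ N := by
  obtain ⟨C, hC⟩ := h.lower_bound
  set S : PiLp 2 (fun _ : Fin d => EucSp m) →L[ℝ] (EucSp d →L[ℝ] EucSp m) :=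
    ((colEquiv d m).symm : PiLp 2 (fun _ : Fin d => EucSp m) →L[ℝ] (EucSp d →L[ℝ] EucSp m)) with hS
  set B : ℝ≥0∞ := (C : ℝ≥0∞) ^ (1 / (q : ℝ≥0∞)).toReal * (ENNReal.ofReal ‖S‖ * V) with hB
  have hBfin : B ≠ ∞ := ENNReal.mul_ne_top
    (ENNReal.rpow_ne_top_of_nonneg ENNReal.toReal_nonneg (by simp))
    (ENNReal.mul_ne_top (by simp) (by simp))
  refine ⟨B.toReal, ENNReal.toReal_nonneg, fun f G hG hV => ?_⟩
  have hle : eLpNorm G q (volume.restrict (interior X)) ≤ B := by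
    refine (eLpNorm_mono_measure _ hC).trans ?_
    change eLpNorm G q ((C : ℝ≥0∞) • σ.fst) ≤ B
    rw [eLpNorm_smul_measure_of_ne_top (by simp), smul_eq_mul, hB]
    gcongr
    refine (eLpNorm_le_mul_eLpNorm_of_ae_le_mul (g := fun x => colEquiv d m (G x)) (c := ‖S‖)
      (Eventually.of_forall fun x => ?_) _).trans (by gcongr)
    have := S.le_opNorm (colEquiv d m (G x))
    simpa [hS] using this
  exact ⟨⟨hG.aestronglyMeasurable, hle.trans_lt hBfin.lt_top⟩, ENNReal.toReal_mono hBfin hle⟩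

/-- Maps with weak gradient in `L^{d+1}` have continuous representatives `X → Y`, and these are
uniformly equicontinuous on `X` under a bound on the norms of the gradients. -/
theorem exists_continuous_representative [IsProbabilityMeasure σ] (h : IsRegularProblem X Y σ ℓ)
    (L : ℝ) (V : ℝ≥0) :
    ∃ rep : (EucSp d → EucSp m) → EucSp d → EucSp m,
      ∀ F : Set (EucSp d → EucSp m),
        (∀ f ∈ F, ∃ G, (f, G) ∈ admissiblePairs X Y σ ℓ L ∧
          eLpNorm (fun x => colEquiv d m (G x)) ((d + 1 : ℕ) : ℝ≥0∞) σ.fst ≤ V) →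
        (∀ f ∈ F, rep f =ᵐ[σ.fst] f ∧ MapsTo (rep f) X Y ∧ ContinuousOn (rep f) X) ∧
        ∀ ε > 0, ∃ δ > 0, ∀ f ∈ F, ∀ x ∈ X, ∀ y ∈ X, dist x y < δ →
          dist (rep f x) (rep f y) < ε := by
  obtain ⟨R, hR0, hR⟩ := h.exists_norm_le
  have hne : (interior X).Nonempty := interior_nonempty_of_absolutelyContinuous h.fst_ac
  obtain ⟨η, hη⟩ := exists_isSmoothWeight isOpen_interior hne
  obtain ⟨N, hN0, hN⟩ := h.exists_eLpNorm_restrict_le (d + 1) V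
  obtain ⟨C, hC0, hC⟩ := IsSmoothWeight.exists_norm_dilAvg_succ_sub_le (m := m)
    h.compact_left h.convex_left hη
  have hvolfin : volume (interior X) ≠ ∞ :=
    ((measure_mono interior_subset).trans_lt h.compact_left.measure_lt_top).ne
  choose K hK using fun k : ℕ => hη.exists_lipschitz_dilAvg (m := m) hvolfin R (2 ^ k)
  set ρ : ℝ := (1 / 2 : ℝ) ^ ((1 : ℝ) / (d + 1)) with hρ
  have hρ0 : 0 ≤ ρ := by positivity
  have hρ1 : ρ < 1 := Real.rpow_lt_one (by norm_num) (by norm_num) (by positivity)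
  refine ⟨fun f x => limUnder atTop fun k : ℕ => dilAvg (interior X) η f (2 ^ k) x,
    fun F hF => ?_⟩
  set rep : (EucSp d → EucSp m) → EucSp d → EucSp m :=
    fun f x => limUnder atTop fun k : ℕ => dilAvg (interior X) η f (2 ^ k) x with hrep
  have hint : ∀ f ∈ F, Integrable f (volume.restrict (interior X)) := fun f hf => by
    obtain ⟨G, hG, -⟩ := hF f hf
    exact h.integrable_restrict_of_mapsTo hG.1 hG.2.1
  have hmaps : ∀ f ∈ F, MapsTo f X Y := fun f hf => by
    obtain ⟨G, hG, -⟩ := hF f hf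
    exact hG.1
  have hstep : ∀ f ∈ F, ∀ x ∈ X, ∀ k : ℕ, dist (dilAvg (interior X) η f (2 ^ k) x)
      (dilAvg (interior X) η f (2 ^ (k + 1)) x) ≤ C * N * ρ ^ k := by
    intro f hf x hx k
    obtain ⟨G, hG, hGV⟩ := hF f hf
    obtain ⟨hGp, hGN⟩ := hN f G hG.2.2.1 hGV
    rw [dist_comm, dist_eq_norm]
    refine (hC f G hG.2.2.1 (hint f hf) hGp x hx k).trans ?_
    gcongr
  have hlim : ∀ f ∈ F, ∀ x ∈ X, Tendsto (fun k : ℕ => dilAvg (interior X) η f (2 ^ k) x) atTop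
      (𝓝 (rep f x)) := fun f hf x hx =>
    (cauchySeq_of_le_geometric ρ (C * N) hρ1 (hstep f hf x hx)).tendsto_limUnder
  have hrate : ∀ f ∈ F, ∀ x ∈ X, ∀ k : ℕ, dist (dilAvg (interior X) η f (2 ^ k) x) (rep f x) ≤
      C * N * ρ ^ k / (1 - ρ) := fun f hf x hx k =>
    dist_le_of_le_geometric_of_tendsto ρ (C * N) hρ1 (hstep f hf x hx) (hlim f hf x hx) k
  have hequi : ∀ ε > 0, ∃ δ > 0, ∀ f ∈ F, ∀ x ∈ X, ∀ y ∈ X, dist x y < δ →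
      dist (rep f x) (rep f y) < ε := by
    intro ε hε
    have h0 : Tendsto (fun k : ℕ => C * N * ρ ^ k / (1 - ρ)) atTop (𝓝 0) := by
      simpa using ((tendsto_pow_atTop_nhds_zero_of_lt_one hρ0 hρ1).const_mul (C * N)).div_const
        (1 - ρ)
    obtain ⟨k, hk⟩ := (h0.eventually (gt_mem_nhds (show (0 : ℝ) < ε / 3 by positivity))).exists
    -- The scale `k` is fixed first, from the uniform geometric rate; the Lipschitz bound at that
    -- scale then gives `δ`. Nothing forces `K k` to be positive, hence `|K k| + 1`.
    refine ⟨ε / 3 / (|K k| + 1), by positivity, fun f hf x hx y hy hxy => ?_⟩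
    have h1 := hrate f hf x hx k
    have h2 := hrate f hf y hy k
    have h3 : dist (dilAvg (interior X) η f (2 ^ k) x) (dilAvg (interior X) η f (2 ^ k) y) <
        ε / 3 := by
      rw [lt_div_iff₀ (by positivity)] at hxy
      rw [dist_eq_norm]
      refine (hK k f (hint f hf) (fun z hz => hR f (hmaps f hf) z (interior_subset hz))
        x y).trans_lt ?_
      rw [← dist_eq_norm]
      refine lt_of_le_of_lt ?_ hxy
      rw [mul_comm]
      gcongr
      linarith [le_abs_self (K k)]
    calc dist (rep f x) (rep f y) ≤ dist (rep f x) (dilAvg (interior X) η f (2 ^ k) x) +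
          dist (dilAvg (interior X) η f (2 ^ k) x) (dilAvg (interior X) η f (2 ^ k) y) +
          dist (dilAvg (interior X) η f (2 ^ k) y) (rep f y) := dist_triangle4 _ _ _ _
      _ < ε := by rw [dist_comm (rep f x)]; linarith
  refine ⟨fun f hf => ?_, hequi⟩
  have hae : rep f =ᵐ[volume.restrict (interior X)] f := by
    filter_upwards [hη.ae_tendsto_dilAvg h.compact_left (hint f hf),
      ae_restrict_mem isOpen_interior.measurableSet] with x hx hxΩ
    exact tendsto_nhds_unique (hlim f hf x (interior_subset hxΩ)) hx
  have hcont : ContinuousOn (rep f) X := by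
    refine Metric.continuousOn_iff.2 fun x hx ε hε => ?_
    obtain ⟨δ, hδ, hδε⟩ := hequi ε hε
    exact ⟨δ, hδ, fun y hy hxy => hδε f hf y hy x hx hxy⟩
  refine ⟨h.fst_ac.ae_le hae, fun x hx => ?_, hcont⟩
  -- The representative takes values in `Y` almost everywhere, hence on a dense subset of the
  -- interior; continuity and closedness of `Y` extend this to all of `X`, the closure of its
  -- interior.
  have hdense : Dense {y | y ∈ interior X → rep f y ∈ Y} := by
    refine Measure.dense_of_ae (μ := volume) ?_
    filter_upwards [(ae_restrict_iff' isOpen_interior.measurableSet).1 hae] with y hy hyΩ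
    rw [hy hyΩ]
    exact hmaps f hf (interior_subset hyΩ)
  have hcl : x ∈ closure (interior X ∩ {y | y ∈ interior X → rep f y ∈ Y}) := by
    have h1 : x ∈ closure (interior X) := by
      rw [h.convex_left.closure_interior_eq_closure_of_nonempty_interior hne]
      exact subset_closure hx
    exact closure_minimal (hdense.open_subset_closure_inter isOpen_interior) isClosed_closure h1
  have := ((hcont x hx).mono (inter_subset_left.trans interior_subset)).mem_closure hcl
    (t := Y) fun y hy => hy.2 hy.1
  rwa [h.compact_right.isClosed.closure_eq] at this

/-- Changing an admissible map on a null set keeps it admissible. -/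
theorem admissiblePairs_congr (h : IsRegularProblem X Y σ ℓ) {L : ℝ} {f f' : EucSp d → EucSp m}
    {G : EucSp d → EucSp d →L[ℝ] EucSp m} (hf : (f, G) ∈ admissiblePairs X Y σ ℓ L)
    (hf' : MapsTo f' X Y) (hff' : f =ᵐ[σ.fst] f') : (f', G) ∈ admissiblePairs X Y σ ℓ L := by
  refine ⟨hf', hf.2.1.congr hff', hf.2.2.1.congr (h.ac_fst.ae_le hff') (ae_eq_refl _), ?_⟩
  refine (integral_congr_ae ?_).symm.trans_le hf.2.2.2
  filter_upwards [ae_of_ae_fst hff'] with z hz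
  rw [hz]

end IsRegularProblem

/-! ### Uniform convergence along subsequences -/

/-- The Arzelà–Ascoli theorem for maps that are uniformly equicontinuous on a compact set. -/
theorem exists_subseq_tendstoUniformlyOn {α β : Type*} [PseudoMetricSpace α] [MetricSpace β]
    {X : Set α} {Y : Set β} (hX : IsCompact X) (hY : IsCompact Y) (g : ℕ → α → β)
    (hg : ∀ n, MapsTo (g n) X Y)
    (hequi : ∀ ε > 0, ∃ δ > 0, ∀ n, ∀ x ∈ X, ∀ y ∈ X, dist x y < δ → dist (g n x) (g n y) < ε) :
    ∃ φ : ℕ → ℕ, StrictMono φ ∧ ∃ gInf : α → β,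
      TendstoUniformlyOn (fun j => g (φ j)) gInf atTop X := by
  rcases X.eq_empty_or_nonempty with rfl | ⟨x₀, hx₀⟩
  · exact ⟨id, strictMono_id, g 0, tendstoUniformlyOn_empty⟩
  classical
  have : CompactSpace X := isCompact_iff_compactSpace.1 hX
  have hcont : ∀ n, Continuous (X.domRestrict (g n)) := fun n => by
    refine Metric.continuous_iff.2 fun x ε hε => ?_
    obtain ⟨δ, hδ, hδε⟩ := hequi ε hε
    exact ⟨δ, hδ, fun y hy => hδε n y y.2 x x.2 hy⟩
  set u : ℕ → BoundedContinuousFunction X β := fun n =>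
    BoundedContinuousFunction.mkOfCompact ⟨X.domRestrict (g n), hcont n⟩ with hu
  have hcpt := BoundedContinuousFunction.arzela_ascoli Y hY (range u)
    (by rintro _ x ⟨n, rfl⟩; exact hg n x.2)
    (by
      refine fun x => Metric.equicontinuousAt_iff.2 fun ε hε => ?_
      obtain ⟨δ, hδ, hδε⟩ := hequi ε hε
      refine ⟨δ, hδ, fun y hy => ?_⟩
      rintro ⟨_, n, rfl⟩
      exact hδε n x x.2 y y.2 (by rwa [dist_comm]))
  obtain ⟨a, -, φ, hφ, hlim⟩ := hcpt.tendsto_subseq (x := u) fun n => subset_closure ⟨n, rfl⟩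
  refine ⟨φ, hφ, fun x => if hx : x ∈ X then a ⟨x, hx⟩ else g 0 x₀, ?_⟩
  rw [tendstoUniformlyOn_iff_tendstoUniformly_comp_coe]
  have := BoundedContinuousFunction.tendsto_iff_tendstoUniformly.1 hlim
  have hval : (fun x => if hx : x ∈ X then a ⟨x, hx⟩ else g 0 x₀) ∘ Subtype.val = a := by
    funext x
    simp
  rw [hval]
  exact this

end

/-! ### Assembly of the theorem -/

theorem isRegularProblem_of_density {d m : ℕ} {X : Set (EucSp d)} {Y : Set (EucSp m)}
    (hXcompact : IsCompact X) (hXconvex : Convex ℝ X)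
    (hYcompact : IsCompact Y) (hYconvex : Convex ℝ Y)
    {σ : Measure (EucSp d × EucSp m)}
    (hσXY : σ (X ×ˢ Y)ᶜ = 0) (hσac : σ ≪ volume)
    (hσX : ∃ c : ℝ≥0, 0 < c ∧ c • volume.restrict X ≤ σ.fst)
    {ℓ : EucSp m → EucSp m → ℝ}
    (hℓconvex : ∀ b ∈ Y, ConvexOn ℝ Y (fun a => ℓ a b))
    (hℓcont : ContinuousOn (fun z : EucSp m × EucSp m => ℓ z.1 z.2) (Y ×ˢ Y)) :
    IsRegularProblem X Y σ ℓ where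
  compact_left := hXcompact
  convex_left := hXconvex
  compact_right := hYcompact
  convex_right := hYconvex
  ae_mem := hσXY
  fst_ac := fst_absolutelyContinuous_interior hXcompact hXconvex hσXY hσac
  lower_bound := by
    obtain ⟨c, hc, hle⟩ := hσX
    refine ⟨c⁻¹, (Measure.restrict_mono interior_subset le_rfl).trans ?_⟩
    calc volume.restrict X = c⁻¹ • (c • volume.restrict X) := by
          rw [smul_smul, inv_mul_cancel₀ hc.ne', one_smul]
      _ ≤ c⁻¹ • σ.fst := by
          refine Measure.le_iff.2 fun s hs => ?_
          rw [Measure.smul_apply, Measure.smul_apply c⁻¹ σ.fst]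
          gcongr
  loss_convex := hℓconvex
  loss_continuous := hℓcont

namespace IsRegularProblem

variable {d m : ℕ} {X : Set (EucSp d)} {Y : Set (EucSp m)} {σ : Measure (EucSp d × EucSp m)}
  {ℓ : EucSp m → EucSp m → ℝ}

/-- Minimizers for finite exponents have continuous representatives, which converge uniformly along
subsequences to minimizers for the exponent `∞`. -/
theorem exists_uniform_limit_of_minimizers [IsProbabilityMeasure σ]
    (h : IsRegularProblem X Y σ ℓ) {α : ℝ≥0} {ε : ℝ} (hε : 0 < ε) {f : ℕ → EucSp d → EucSp m}
    (hf : ∀ p : ℕ, 1 < p → IsLossConstrainedMin X Y σ ℓ α ε p (f p)) :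
    ∃ g : ℕ → EucSp d → EucSp m,
      (∀ p : ℕ, 1 < p → d < p →
        ContinuousOn (g p) X ∧ MapsTo (g p) X Y ∧ g p =ᵐ[σ.fst] f p) ∧
      ∀ ψ : ℕ → ℕ, StrictMono ψ →
        ∃ φ : ℕ → ℕ, StrictMono φ ∧ ∃ fInf : EucSp d → EucSp m,
          IsLossConstrainedMin X Y σ ℓ α ε ∞ fInf ∧
          TendstoUniformlyOn (fun j => g (ψ (φ j))) fInf atTop X := by
  obtain ⟨K, hK⟩ := h.exists_lossConstrainedValue_le (α := α) hε
  obtain ⟨rep, hrep⟩ := h.exists_continuous_representative (optimalLoss X Y σ ℓ α + ε) K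
  obtain ⟨hreg, hequi⟩ := hrep (f '' {p | 1 < p ∧ d < p}) (by
    rintro _ ⟨p, ⟨hp1, hpd⟩, rfl⟩
    obtain ⟨hmem, hle⟩ := isLossConstrainedMin_iff.1 (hf p hp1)
    obtain ⟨G, hG, hs⟩ := h.exists_of_mem_feasibleSet hmem
    refine ⟨G, hG, ?_⟩
    have hexp : ((d + 1 : ℕ) : ℝ≥0∞) ≤ (p : ℝ≥0∞) := by exact_mod_cast hpd
    refine (eLpNorm_le_eLpNorm_of_exponent_le hexp
      (h.aestronglyMeasurable_colEquiv hG.2.2.1)).trans ?_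
    rw [← hs]
    exact hle.trans (hK p))
  refine ⟨fun p => rep (f p), fun p hp1 hpd => ?_, fun ψ hψ => ?_⟩
  · obtain ⟨h1, h2, h3⟩ := hreg (f p) ⟨p, ⟨hp1, hpd⟩, rfl⟩
    exact ⟨h3, h2, h1⟩
  -- Since `ψ n ≥ n`, dropping `d + 2` terms secures both `p > 1` and `p > d`, so that only the
  -- equicontinuous representatives remain.
  have hlarge : ∀ j, 1 < ψ (j + (d + 2)) ∧ d < ψ (j + (d + 2)) := fun j => by
    have := hψ.id_le (j + (d + 2))
    simp only [id] at this
    omega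
  have hmemF : ∀ j, f (ψ (j + (d + 2))) ∈ f '' {p | 1 < p ∧ d < p} := fun j =>
    ⟨_, hlarge j, rfl⟩
  obtain ⟨φ, hφ, fInf, hfInf⟩ := exists_subseq_tendstoUniformlyOn h.compact_left h.compact_right
    (fun j => rep (f (ψ (j + (d + 2))))) (fun j => (hreg _ (hmemF j)).2.1) (fun ε hε => by
      obtain ⟨δ, hδ, hδε⟩ := hequi ε hε
      exact ⟨δ, hδ, fun n => hδε _ (hmemF n)⟩)
  refine ⟨fun j => φ j + (d + 2), hφ.add_const _, fInf, ?_, hfInf⟩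
  have hmono : StrictMono fun j => ψ (φ j + (d + 2)) := hψ.comp (hφ.add_const _)
  obtain ⟨g, G, hgG, hle, hlim⟩ := h.exists_limit_of_minimizers hε hmono
    (fun j => (hlarge (φ j)).1) (fun j => hf _ (hlarge (φ j)).1)
  have hmaps : MapsTo fInf X Y := fun x hx =>
    h.compact_right.isClosed.mem_of_tendsto (hfInf.tendsto_at hx)
      (Eventually.of_forall fun j => (hreg _ (hmemF (φ j))).2.1 hx)
  -- Uniform convergence of the representatives gives almost everywhere convergence of the
  -- minimizers themselves; this identifies `g` with `fInf` and transfers minimality.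
  have hgf : g =ᵐ[σ.fst] fInf := by
    refine hlim fInf ?_
    filter_upwards [h.ae_fst_mem, ae_all_iff.2 fun j => (hreg _ (hmemF (φ j))).1] with x hx hrx
    exact (hfInf.tendsto_at hx).congr hrx
  exact h.isLossConstrainedMin_of_le hε (h.admissiblePairs_congr hgG hmaps hgf)
    (hle.trans (iSup_le fun n => h.lossConstrainedValue_mono le_top α ε))

end IsRegularProblem

theorem theorem3 (d m : ℕ) (X : Set (EucSp d)) (Y : Set (EucSp m))
    (hXcompact : IsCompact X) (hXconvex : Convex ℝ X)
    (hYcompact : IsCompact Y) (hYconvex : Convex ℝ Y)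
    (σ : Measure (EucSp d × EucSp m)) [IsProbabilityMeasure σ]
    (hσXY : σ (X ×ˢ Y)ᶜ = 0) (hσac : σ ≪ volume)
    -- the density of the marginal is bounded below on `X` by a positive constant
    (hσX : ∃ c : ℝ≥0, 0 < c ∧ c • volume.restrict X ≤ σ.fst)
    (ℓ : EucSp m → EucSp m → ℝ)
    (hℓnonneg : ∀ a ∈ Y, ∀ b ∈ Y, 0 ≤ ℓ a b)
    (hℓconvex : ∀ b ∈ Y, StrictConvexOn ℝ Y (fun a => ℓ a b))
    (hℓlip : ∃ K : ℝ≥0, LipschitzOnWith K (fun z : EucSp m × EucSp m => ℓ z.1 z.2) (Y ×ˢ Y))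
    (α : ℝ≥0) (ε : ℝ) (hε : 0 < ε) :
    -- all the minima are attained (in particular the values are finite)
    (∀ p : ℕ, 1 < p → ∃ f, IsLossConstrainedMin X Y σ ℓ α ε p f) ∧
    (∃ f, IsLossConstrainedMin X Y σ ℓ α ε ∞ f) ∧
    -- the minimum values converge
    Tendsto (fun p : ℕ => lossConstrainedValue X Y σ ℓ α ε p) atTop
      (𝓝 (lossConstrainedValue X Y σ ℓ α ε ∞)) ∧
    -- the minimizers (continuous representatives) converge uniformly along subsequences
    (∀ f : ℕ → EucSp d → EucSp m,
      (∀ p : ℕ, 1 < p → IsLossConstrainedMin X Y σ ℓ α ε p (f p)) →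
      ∃ g : ℕ → EucSp d → EucSp m,
        (∀ p : ℕ, 1 < p → d < p →
          ContinuousOn (g p) X ∧ MapsTo (g p) X Y ∧ g p =ᵐ[σ.fst] f p) ∧
        ∀ ψ : ℕ → ℕ, StrictMono ψ →
          ∃ φ : ℕ → ℕ, StrictMono φ ∧ ∃ fInf : EucSp d → EucSp m,
            IsLossConstrainedMin X Y σ ℓ α ε ∞ fInf ∧
            TendstoUniformlyOn (fun j => g (ψ (φ j))) fInf atTop X) := by
  obtain ⟨K, hK⟩ := hℓlip
  have h : IsRegularProblem X Y σ ℓ := isRegularProblem_of_density hXcompact hXconvex hYcompact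
    hYconvex hσXY hσac hσX (fun b hb => (hℓconvex b hb).convexOn) hK.continuousOn
  refine ⟨fun p hp => h.exists_isLossConstrainedMin α hε (by exact_mod_cast hp),
    h.exists_isLossConstrainedMin α hε le_top, h.tendsto_lossConstrainedValue α hε,
    fun f hf => h.exists_uniform_limit_of_minimizers hε hf⟩
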